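/- **Setting.** Let $\tilde G$ be a finite two-player extensive-form game tree with chance moves and perfect recall, with set of terminal nodes $Z$. A zero-sum pseudogame with possibly unbounded payoffs $(\tilde G,\alpha,\beta)$ has, instead of utilities, bounds $\alpha_i(z)\le\beta_i(z)$ for each player $i\in\{1,2\}$ and $z\in Z$, with $\beta_i(z)\in(-\infty,+\infty]$, $\alpha_i(z)\in[-\infty,+\infty)$, $\alpha_2=-\beta_1$ and $\beta_2=-\alpha_1$. A terminal node $z$ is *pseudoterminal* if $\alpha_i(z)<\beta_i(z)$ for some $i$. Strategies are behavior strategies, expectations use the convention $0\cdot(\pm\infty)=0$, and the support of a profile is the set of terminal nodes that it reaches with positive probability. A profile $(x,y)$ is a *$0$-Nash equilibrium* if $$\sup_{x'}\beta_1(x',y)-\inf_{y'}\alpha_1(x,y')\le 0 .$$ **Optimistic profiles.** For player $i$ with opponent $-i$, call a sequence $s$ of player $-i$ *bad* if, for some terminal node $z$ whose sequence for player $-i$ is exactly $s$, nature's contribution to the reach probability of $z$ is positive and $\beta_i(z)=+\infty$. If player $-i$ has a strategy that gives probability $0$ to all bad sequences, a strategy of player $i$ is *optimistic* if it maximizes the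 minimum of $\beta_i$ over all such strategies of player $-i$. Otherwise the game with utility $\beta_i$ has value $+\infty$ for player $i$, and a strategy is *optimistic* if it gets $\beta_i=+\infty$ against every strategy of player $-i$. An *optimistic profile* $(x,y)$ consists of optimistic strategies $x$ of player 1 and $y$ of player 2. **Correction.** Let $x$ be a strategy of player $i$. For an information set $I$ of player $-i$ and an action $a$ at $I$, let $V^*_x(Ia)$ be the infimum, over all continuation strategies of player $-i$ after the sequence $Ia$, of the expectation of $\beta_i$ over the terminal nodes whose sequence for player $-i$ extends $Ia$, weighted with the reach probabilities of nature and of $x$. Let $V_x(I)$ be the same infimum from $I$ on, over the continuations that avoid all bad sequences ($+\infty$ if there is none). For $\varepsilon>0$, the procedure $\mathrm{Correct}(I)$ updates the current strategy $x$ as follows. For each action $a$ at $I$: if $V^*_x(Ia)<V_x(I)$, then * add mass to every sequence $r$ of player $i$ whose payoff against $Ia$ is $+\infty$: simultaneously for all these $r$, raise by $\varepsilon$ the weight of each move occurring in some such $r$, and renormalize at each information set; * then run $\mathrm{Correct}(I')$ for every information set $I'$ of player $-i$ whose parent sequence is $Ia$. Let $x^\varepsilon$ be the result of running this on all root information sets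 of player $-i$ (those with empty parent sequence), starting from $x$. A *corrected optimistic profile* is a family $(x^\varepsilon,y^\varepsilon)_{\varepsilon>0}$ obtained in this way from both parts of an optimistic profile $(x,y)$, where $\varepsilon$ plays the role of an infinitesimal. It has no pseudoterminal node in its support if this holds for $(x^\varepsilon,y^\varepsilon)$ for all sufficiently small $\varepsilon>0$. **Theorem.** For every fixed order in which the loops of the correction procedure run through actions and information sets, the pseudogame $(\tilde G,\alpha,\beta)$ has a $0$-Nash equilibrium if and only if it has a corrected optimistic profile with no pseudoterminal node in its support. -/

import Mathlib

open scoped NNReal Topology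

noncomputable section

namespace ZeroSum

universe u v

/-- The two strategic players. -/
inductive Player where
  | one
  | two

/-- The opponent of a player. -/
def Player.opp : Player → Player
  | .one => .two
  | .two => .one

open Classical in
/-- The actions labelling the edges from `h` to its children in the tree of histories `H`. -/
def childActions {A : Type u} (H : Finset (List A)) (h : List A) : Finset A :=
  (H.biUnion List.toFinset).filter fun a => h ++ [a] ∈ H

theorem mem_childActions {A : Type u} {H : Finset (List A)} {h : List A} {a : A} :
    a ∈ childActions H h ↔ h ++ [a] ∈ H := by
  classical
  unfold childActions
  simp only [Finset.mem_filter, Finset.mem_biUnion, List.mem_toFinset, and_iff_right_iff_imp]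
  intro ha
  exact ⟨h ++ [a], ha, by simp⟩

/-- The tree, information sets and chance moves of a finite two-player extensive-form game.
Histories are lists of actions (first action first); `A` is the type of actions and `Info i` the
type of information sets of player `i`. -/
structure GameTree (A : Type u) (Info : Player → Type v) where
  /-- the finite tree of histories -/
  hist : Finset (List A)
  root_mem : [] ∈ hist
  parent_mem : ∀ h a, h ++ [a] ∈ hist → h ∈ hist
  /-- who acts at a nonterminal history: nature (`none`), or player `i` at information
  set `J` (`some ⟨i, J⟩`); irrelevant at terminal histories -/
  turn : List A → Option (Σ i, Info i)
  /-- the actions available at an information set -/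
  acts : ∀ i, Info i → Finset A
  acts_eq : ∀ i J, ∀ h ∈ hist, childActions hist h ≠ ∅ → turn h = some ⟨i, J⟩ →
    acts i J = childActions hist h
  /-- information sets are nonempty -/
  info_nonempty : ∀ i J, ∃ h ∈ hist, childActions hist h ≠ ∅ ∧ turn h = some ⟨i, J⟩
  /-- nature's action distributions -/
  chance : List A → A → ℝ
  chance_nonneg : ∀ h ∈ hist, turn h = none → ∀ a ∈ childActions hist h, 0 ≤ chance h a
  chance_sum : ∀ h ∈ hist, childActions hist h ≠ ∅ → turn h = none →
    ∑ a ∈ childActions hist h, chance h a = 1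

namespace GameTree

variable {A : Type u} {Info : Player → Type v} (T : GameTree A Info)

open Classical in
/-- The terminal histories (leaves). -/
def terminals : Finset (List A) := T.hist.filter fun h => childActions T.hist h = ∅

/-- `h` is a decision node belonging to information set `J` of player `i`. -/
def InInfo {i : Player} (J : Info i) (h : List A) : Prop :=
  h ∈ T.hist ∧ childActions T.hist h ≠ ∅ ∧ T.turn h = some ⟨i, J⟩

open Classical in
/-- What action `a`, taken at `h`, contributes to the sequence of player `i`. -/
def ownMove (i : Player) (h : List A) (a : A) : List (Info i × A) :=
  match T.turn h with
  | none => []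
  | some m => if e : m.1 = i then [(e ▸ m.2, a)] else []

/-- The information sets observed and actions taken by player `i` along `t`, starting from `h`. -/
def seqFrom (i : Player) : List A → List A → List (Info i × A)
  | _, [] => []
  | h, a :: t => T.ownMove i h a ++ seqFrom i (h ++ [a]) t

/-- The sequence of player `i` at the history `h`. -/
def seq (i : Player) (h : List A) : List (Info i × A) := T.seqFrom i [] h

open Classical in
/-- Product of nature's probabilities along `t`, starting from `h`. -/
def chanceFrom : List A → List A → ℝ
  | _, [] => 1
  | h, a :: t => (if T.turn h = none then T.chance h a else 1) * chanceFrom (h ++ [a]) t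

/-- Nature's contribution to the reach probability of `h`. -/
def chanceReach (h : List A) : ℝ := T.chanceFrom [] h

/-- Perfect recall: all nodes of an information set carry the same sequence of its owner. -/
def PerfectRecall : Prop :=
  ∀ (i : Player) (J : Info i) (h h' : List A), T.InInfo J h → T.InInfo J h' →
    T.seq i h = T.seq i h'

/-- The parent sequence of an information set (that of any of its nodes). -/
def infoSeq {i : Player} (J : Info i) : List (Info i × A) :=
  T.seq i (T.info_nonempty i J).choose

theorem infoSeq_eq (hT : T.PerfectRecall) {i : Player} {J : Info i} {h : List A}
    (hh : T.InInfo J h) : T.infoSeq J = T.seq i h :=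
  hT i J _ _ (T.info_nonempty i J).choose_spec hh

/-- The sequence of `J`'s owner that leads to `J` and then takes action `a`. -/
def actSeq {i : Player} (J : Info i) (a : A) : List (Info i × A) := T.infoSeq J ++ [(J, a)]

/-- A behavior strategy of player `i`. -/
@[ext]
structure Strategy (i : Player) where
  prob : Info i → A → ℝ
  nonneg : ∀ J a, 0 ≤ prob J a
  eq_zero : ∀ J, ∀ a ∉ T.acts i J, prob J a = 0
  sum_one : ∀ J, ∑ a ∈ T.acts i J, prob J a = 1

variable {T}

/-- The product of the probabilities of the moves in a (part of a) sequence. -/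
def Strategy.weight {i : Player} (x : T.Strategy i) (s : List (Info i × A)) : ℝ :=
  (s.map fun m => x.prob m.1 m.2).prod

open Classical in
/-- The strategy `x` after adding a small mass to each sequence in `S`: the weight of every move
that occurs in a sequence of `S` is raised by `ε`, and the result is renormalized at each
information set, so that it is again a strategy. -/
def Strategy.addMass {i : Player} (x : T.Strategy i) (S : Set (List (Info i × A))) (ε : ℝ≥0) :
    T.Strategy i where
  prob J a := (x.prob J a + if a ∈ T.acts i J ∧ ∃ s ∈ S, (J, a) ∈ s then (ε : ℝ) else 0) /
    (1 + ∑ b ∈ T.acts i J, if ∃ s ∈ S, (J, b) ∈ s then (ε : ℝ) else 0)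
  nonneg J a := by
    have h1 : (0 : ℝ) ≤ ∑ b ∈ T.acts i J, if ∃ s ∈ S, (J, b) ∈ s then (ε : ℝ) else 0 :=
      Finset.sum_nonneg fun b _ => by split_ifs <;> simp
    refine div_nonneg (add_nonneg (x.nonneg J a) ?_) (by linarith)
    split_ifs <;> simp
  eq_zero J a ha := by simp [x.eq_zero J a ha, ha]
  sum_one J := by
    have h1 : (0 : ℝ) ≤ ∑ b ∈ T.acts i J, if ∃ s ∈ S, (J, b) ∈ s then (ε : ℝ) else 0 :=
      Finset.sum_nonneg fun b _ => by split_ifs <;> simp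
    rw [← Finset.sum_div, Finset.sum_add_distrib, x.sum_one J]
    have h2 : (∑ a ∈ T.acts i J, if a ∈ T.acts i J ∧ ∃ s ∈ S, (J, a) ∈ s then (ε : ℝ) else 0) =
        ∑ b ∈ T.acts i J, if ∃ s ∈ S, (J, b) ∈ s then (ε : ℝ) else 0 :=
      Finset.sum_congr rfl fun b hb => by simp [hb]
    rw [h2]
    exact div_self (by linarith)

/-- The probability that `z` is reached under the profile `(x, y)`. -/
def reach (i : Player) (x : T.Strategy i) (y : T.Strategy i.opp) (z : List A) : ℝ :=
  T.chanceReach z * x.weight (T.seq i z) * y.weight (T.seq i.opp z)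

/-- The expectation of the extended-real utility `w` under the profile `(x, y)`; terminal nodes
of reach probability zero contribute zero. -/
def value (w : List A → EReal) (i : Player) (x : T.Strategy i) (y : T.Strategy i.opp) : EReal :=
  ∑ z ∈ T.terminals, (reach i x y z : EReal) * w z

variable (T)

/-- The order in which the loops of the correction procedure run through the information sets
and through the actions. -/
structure LoopOrder where
  infos : ∀ i, List (Info i)
  infos_nodup : ∀ i, (infos i).Nodup
  mem_infos : ∀ i J, J ∈ infos i
  acts : ∀ i, Info i → List A
  acts_nodup : ∀ i J, (acts i J).Nodup
  mem_acts : ∀ i J a, a ∈ acts i J ↔ a ∈ T.acts i J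

end GameTree

/-- A two-player zero-sum pseudogame with perfect recall and possibly infinite bounds: upper
bounds may be `+∞` but not `-∞`, and hence lower bounds may be `-∞` but not `+∞`. -/
structure Pseudogame (A : Type u) (Info : Player → Type v) extends GameTree A Info where
  perfectRecall : toGameTree.PerfectRecall
  /-- lower bounds on the utilities of each player -/
  lower : Player → List A → EReal
  /-- upper bounds on the utilities of each player -/
  upper : Player → List A → EReal
  lower_le_upper : ∀ i, ∀ z ∈ toGameTree.terminals, lower i z ≤ upper i z
  bot_lt_upper : ∀ i, ∀ z ∈ toGameTree.terminals, ⊥ < upper i z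
  zero_sum : ∀ i, ∀ z ∈ toGameTree.terminals, lower i.opp z = - upper i z

namespace Pseudogame

open GameTree

variable {A : Type u} {Info : Player → Type v} (G : Pseudogame A Info)

/-- The strategies of player `i`. -/
abbrev Strat (i : Player) := G.toGameTree.Strategy i

/-- A terminal node at which some utility is not exactly specified. -/
def Pseudoterminal (z : List A) : Prop :=
  z ∈ G.terminals ∧ ∃ i, G.lower i z < G.upper i z

/-- The best-response value `β^*(y)` of player one in the game with the upper bounds. -/
def upperBR (y : G.Strat .two) : EReal := ⨆ x : G.Strat .one, value (G.upper .one) .one x y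

/-- The value `α^*(x)` of a best response of player two in the game with the lower bounds. -/
def lowerBR (x : G.Strat .one) : EReal := ⨅ y : G.Strat .two, value (G.lower .one) .one x y

/-- `(x, y)` is an `ε`-Nash equilibrium of the zero-sum pseudogame. -/
def IsNash (ε : ℝ) (x : G.Strat .one) (y : G.Strat .two) : Prop :=
  G.upperBR y - G.lowerBR x ≤ (ε : EReal)

open Classical in
/-- The sequence-form payoff of player `i` under her upper bounds, for a sequence `r` of hers and
a sequence `s` of her opponent. -/
def payoff (i : Player) (r : List (Info i × A)) (s : List (Info i.opp × A)) : EReal :=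
  ∑ z ∈ G.terminals.filter fun z => G.seq i z = r ∧ G.seq i.opp z = s,
    (G.chanceReach z : EReal) * G.upper i z

/-- A sequence of the opponent of `i` is bad if a terminal node that it leads to (with nature's
help) has upper bound `+∞` for player `i`. -/
def Bad (i : Player) (s : List (Info i.opp × A)) : Prop :=
  ∃ z ∈ G.terminals, G.seq i.opp z = s ∧ 0 < G.chanceReach z ∧ G.upper i z = ⊤

/-- The opponent's strategy `y` never plays a bad sequence. -/
def Avoids (i : Player) (y : G.Strat i.opp) : Prop := ∀ s, G.Bad i s → y.weight s = 0

/-- The opponent can avoid all bad sequences. -/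
def Avoidable (i : Player) : Prop := ∃ y, G.Avoids i y

/-- What `x` guarantees player `i` against opponents who avoid all bad sequences. -/
def avoidValue (i : Player) (x : G.Strat i) : EReal :=
  ⨅ y : {y : G.Strat i.opp // G.Avoids i y}, value (G.upper i) i x y.1

/-- `x` is player `i`'s part of an optimistic profile. If the opponent can avoid all bad
sequences, `x` is a maximin strategy of player `i` for her upper bounds, where the opponent's
bad sequences have been removed. Otherwise the value of the game with the upper bounds is `+∞`,
and `x` has to attain it. -/
def IsOptimistic (i : Player) (x : G.Strat i) : Prop :=
  (G.Avoidable i → ∀ x', G.avoidValue i x' ≤ G.avoidValue i x) ∧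
  (¬ G.Avoidable i → ∀ y, value (G.upper i) i x y = ⊤)

open Classical in
/-- The value, starting at the opponent's sequence `I a`, when the opponent best-responds to `x`
from there on (weighted by the reach of player `i` and nature, as in the sequence form). -/
def bestValue {i : Player} (x : G.Strat i) (I : Info i.opp) (a : A) : EReal :=
  ⨅ y : G.Strat i.opp,
    ∑ z ∈ G.terminals.filter fun z => G.actSeq I a <+: G.seq i.opp z,
      ((G.chanceReach z * x.weight (G.seq i z) *
        y.weight ((G.seq i.opp z).drop (G.actSeq I a).length) : ℝ) : EReal) * G.upper i z

/-- Starting from the information set `I`, the strategy `y` never plays a bad sequence. -/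
def AvoidsFrom {i : Player} (I : Info i.opp) (y : G.Strat i.opp) : Prop :=
  ∀ s, G.Bad i s → (∃ a, G.actSeq I a <+: s) → y.weight (s.drop (G.infoSeq I).length) = 0

open Classical in
/-- The value, starting at the opponent's information set `I`, when the opponent best-responds to
`x` from there on among the strategies that avoid all bad sequences (`+∞` if there is none). -/
def restrictedValue {i : Player} (x : G.Strat i) (I : Info i.opp) : EReal :=
  ⨅ y : {y : G.Strat i.opp // G.AvoidsFrom I y},
    ∑ z ∈ G.terminals.filter fun z => ∃ a, G.actSeq I a <+: G.seq i.opp z,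
      ((G.chanceReach z * x.weight (G.seq i z) *
        y.1.weight ((G.seq i.opp z).drop (G.infoSeq I).length) : ℝ) : EReal) * G.upper i z

open Classical in
/-- The recursive correction of the strategy `x` of player `i` at the opponent's information set
`I`, with the infinitesimal replaced by `ε`. The first argument bounds the recursion depth. -/
def correct {i : Player} (o : G.toGameTree.LoopOrder) (ε : ℝ≥0) :
    ℕ → G.Strat i → Info i.opp → G.Strat i
  | 0, x, _ => x
  | n + 1, x, I =>
    (o.acts i.opp I).foldl (fun x a =>
      if G.bestValue x I a < G.restrictedValue x I then
        ((o.infos i.opp).filter fun I' => G.infoSeq I' = G.actSeq I a).foldl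
          (fun x I' => correct o ε n x I')
          (x.addMass {r | G.payoff i r (G.actSeq I a) = ⊤} ε)
      else x) x

open Classical in
/-- The correction run on all root information sets of the opponent. Information sets visited
along a chain of recursive calls are distinct, so the depth bound never cuts the recursion short. -/
def corrected {i : Player} (o : G.toGameTree.LoopOrder) (ε : ℝ≥0) (x : G.Strat i) : G.Strat i :=
  ((o.infos i.opp).filter fun I => G.infoSeq I = []).foldl
    (fun x I => G.correct o ε (o.infos i.opp).length x I) x

/-- A corrected optimistic profile: both parts of an optimistic profile, corrected; as the
correction uses infinitesimals, this is a family of strategy profiles indexed by `ε`. -/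
def IsCorrectedOptimistic (o : G.toGameTree.LoopOrder)
    (x : ℝ≥0 → G.Strat .one) (y : ℝ≥0 → G.Strat .two) : Prop :=
  ∃ (x₀ : G.Strat .one) (y₀ : G.Strat .two), G.IsOptimistic .one x₀ ∧ G.IsOptimistic .two y₀ ∧
    (∀ ε, x ε = G.corrected o ε x₀) ∧ (∀ ε, y ε = G.corrected o ε y₀)

/-- No pseudoterminal node is in the support of the profile `(x, y)`. -/
def NoPseudoterminalInSupport (x : G.Strat .one) (y : G.Strat .two) : Prop :=
  ∀ z, G.Pseudoterminal z → ¬ 0 < reach .one x y z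

end Pseudogame

end ZeroSum

end

/-! An equilibrium $(x,y)$ pinches everything:
$\beta_1(x',y)\le\beta^*(y)\le\alpha^*(x)\le\alpha_1(x,y')\le\beta_1(x,y')$ for all $x',y'$. So
$(x,y)$ is a saddle point with finite value for $\beta_1$, and symmetrically $(y,x)$ is one for
$\beta_2$. Finiteness makes both strategies avoid the bad sequences, and the saddle inequalities
make them optimistic. Since $y$ is a best response to $x$ among all strategies, no action at a root
information set passes the test of the correction, which therefore changes nothing. Finally
$\beta_1(x,y)\le\alpha_1(x,y)$ leaves no gap between the bounds on the support. The constant family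
does the job (`exists_correctedOptimistic_of_isNash`).

For the converse, the equilibrium is not the corrected profile itself. Let $v_i$ be what the
optimistic strategy of player $i$ guarantees against avoiding opponents. Minimax on realization
vectors (`exists_avoids_forall_value_le`) gives an avoiding opponent who holds player $i$ to $v_i$
against all strategies; the two strategies so obtained form an equilibrium as soon as $v_1+v_2\le
0$.

This inequality comes from the corrected profile. The main estimate
(`exists_avoidValue_le_corrected`) says that $v_i\le\beta_i(x^\varepsilon,y)+C\varepsilon$ for every
$y$, avoiding or not, that meets no infinite bound against $x^\varepsilon$. Taken for both players
at $(x^\varepsilon,y^\varepsilon)$, where $\beta_1=-\beta_2$ on the support, it gives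
$v_1+v_2\le(C+C')\varepsilon$, and $\varepsilon\to0$.

The estimate is an induction down the opponent's tree (`correctEffective`). Follow an action $a$ at
$I$ that $y$ plays and that costs at most the average. If the correction did nothing for $a$, then
avoiding from $I$ on was already as good for the opponent as any continuation after $Ia$. If it
added mass, a bad $Ia$ would now meet $+\infty$, so $Ia$ is not bad, and the avoiding continuations
found below it can be glued together. All other changes to the strategy move expectations by
$O(\varepsilon)$ and never shrink its support. -/

noncomputable section

namespace ZeroSum

universe u v

namespace GameTree

variable {A : Type u} {Info : Player → Type v} {T : GameTree A Info}

/-! ### Sequences of moves and perfect recall. -/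

section Sequences

theorem mem_hist_of_prefix {h h' : List A} (hp : h <+: h') (hh : h' ∈ T.hist) : h ∈ T.hist := by
  obtain ⟨t, rfl⟩ := hp
  induction t using List.reverseRecOn with
  | nil => simpa using hh
  | append_singleton t a ih => exact ih (T.parent_mem _ a (by simpa using hh))

theorem seqFrom_append (i : Player) (t t' : List A) :
    ∀ h, T.seqFrom i h (t ++ t') = T.seqFrom i h t ++ T.seqFrom i (h ++ t) t' := by
  induction t with
  | nil => simp [seqFrom]
  | cons a t ih => intro h; simp [seqFrom, ih]

theorem seq_snoc (i : Player) (h : List A) (a : A) :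
    T.seq i (h ++ [a]) = T.seq i h ++ T.ownMove i h a := by
  simp [seq, seqFrom_append, seqFrom]

theorem ownMove_cases (i : Player) (h : List A) (a : A) :
    T.ownMove i h a = [] ∨ ∃ J, T.turn h = some ⟨i, J⟩ ∧ T.ownMove i h a = [(J, a)] := by
  unfold ownMove
  rcases hm : T.turn h with _ | ⟨k, J⟩
  · exact Or.inl rfl
  · by_cases e : k = i
    · subst e
      exact Or.inr ⟨J, rfl, by simp⟩
    · exact Or.inl (by simp [e])

/-- Each move in the sequence of a history is made at a decision node that precedes it. -/
theorem exists_node_of_seq_eq {i : Player} {J : Info i} {a : A} {s t : List (Info i × A)}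
    {h : List A} (hh : h ∈ T.hist) (hs : T.seq i h = s ++ (J, a) :: t) :
    ∃ h₀, h₀ ++ [a] ∈ T.hist ∧ T.InInfo J h₀ ∧ T.seq i h₀ = s := by
  induction h using List.reverseRecOn generalizing t with
  | nil => simp [seq, seqFrom] at hs
  | append_singleton h b ih =>
    have hh' := T.parent_mem _ _ hh
    rw [seq_snoc] at hs
    rcases T.ownMove_cases i h b with h0 | ⟨K, hK, h1⟩
    · rw [h0, List.append_nil] at hs
      exact ih hh' hs
    · rw [h1] at hs
      rcases List.eq_nil_or_concat t with rfl | ⟨t', m, rfl⟩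
      · obtain ⟨hs', hm⟩ := List.append_inj' hs rfl
        simp only [List.cons.injEq, Prod.mk.injEq, and_true] at hm
        obtain ⟨rfl, rfl⟩ := hm
        exact ⟨h, hh, ⟨hh', Finset.ne_empty_of_mem (mem_childActions.2 hh), hK⟩, hs'⟩
      · have : s ++ (J, a) :: t'.concat m = (s ++ (J, a) :: t') ++ [m] := by simp
        rw [List.concat_eq_append] at this
        simp only [List.concat_eq_append] at hs
        rw [this] at hs
        exact ih hh' (List.append_inj' hs rfl).1

/-- This is the form in which perfect recall is used: whatever precedes a move at `J` in a sequence
is forced by `J`. -/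
theorem infoSeq_of_seq_eq (hT : T.PerfectRecall) {i : Player} {J : Info i} {a : A}
    {s t : List (Info i × A)} {h : List A} (hh : h ∈ T.hist)
    (hs : T.seq i h = s ++ (J, a) :: t) : T.infoSeq J = s ∧ a ∈ T.acts i J := by
  obtain ⟨h₀, h1, h2, h3⟩ := exists_node_of_seq_eq hh hs
  refine ⟨(T.infoSeq_eq hT h2).trans h3, ?_⟩
  rw [T.acts_eq i J h₀ h2.1 h2.2.1 h2.2.2]
  exact mem_childActions.2 h1

theorem infoSeq_mem (i : Player) (J : Info i) : ∃ h ∈ T.hist, T.seq i h = T.infoSeq J :=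
  ⟨_, (T.info_nonempty i J).choose_spec.1, rfl⟩

theorem infoSeq_of_infoSeq_eq (hT : T.PerfectRecall) {i : Player} {I J : Info i} {a : A}
    {s t : List (Info i × A)} (hs : T.infoSeq I = s ++ (J, a) :: t) :
    T.infoSeq J = s ∧ a ∈ T.acts i J := by
  obtain ⟨h, hh, he⟩ := T.infoSeq_mem i I
  exact infoSeq_of_seq_eq hT hh (he.trans hs)

theorem mem_hist_of_mem_terminals {z : List A} (hz : z ∈ T.terminals) : z ∈ T.hist := by
  classical
  unfold terminals at hz
  exact (Finset.mem_filter.1 hz).1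

theorem acts_nonempty (i : Player) (J : Info i) : (T.acts i J).Nonempty := by
  obtain ⟨h, hh, hc, ht⟩ := T.info_nonempty i J
  rw [T.acts_eq i J h hh hc ht]
  exact Finset.nonempty_iff_ne_empty.2 hc

/-- The parent sequence of the information set at position $k$ is the initial segment of length $k$,
so different positions carry different information sets. This bounds the recursion depth of the
correction. -/
theorem nodup_infoSeq (hT : T.PerfectRecall) {i : Player} (J : Info i) :
    ((T.infoSeq J).map Prod.fst ++ [J]).Nodup := by
  have key : ∀ K, K ∈ (T.infoSeq J).map Prod.fst →
      (T.infoSeq K).length < (T.infoSeq J).length := by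
    intro K hK
    simp only [List.mem_map, Prod.exists, exists_and_right, exists_eq_right] at hK
    obtain ⟨a, ha⟩ := hK
    obtain ⟨s, t, hst⟩ := List.append_of_mem ha
    rw [(infoSeq_of_infoSeq_eq hT hst).1, hst]
    simp
  rw [List.nodup_append]
  refine ⟨?_, by simp, ?_⟩
  · rw [List.nodup_iff_injective_get]
    have aux : ∀ (k : ℕ) (hk : k < (T.infoSeq J).length),
        (T.infoSeq ((T.infoSeq J)[k]).1).length = k := by
      intro k hk
      have : T.infoSeq J = (T.infoSeq J).take k ++
          (((T.infoSeq J)[k]).1, ((T.infoSeq J)[k]).2) :: (T.infoSeq J).drop (k + 1) := by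
        conv_lhs => rw [← List.take_append_drop k (T.infoSeq J)]
        rw [List.drop_eq_getElem_cons hk]
      rw [(infoSeq_of_infoSeq_eq hT this).1, List.length_take, min_eq_left hk.le]
    rintro ⟨k, hk⟩ ⟨l, hl⟩ hkl
    simp only [List.get_eq_getElem, List.getElem_map] at hkl
    simp only [List.length_map] at hk hl
    have h1 := aux k hk
    rw [hkl, aux l hl] at h1
    simp [h1]
  · rintro K hK L hL rfl
    simp only [List.mem_singleton] at hL
    subst hL
    exact lt_irrefl _ (key _ hK)

theorem length_infoSeq_lt [Fintype (Info i)] (hT : T.PerfectRecall) (J : Info i) :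
    (T.infoSeq J).length < Fintype.card (Info i) := by
  have := (nodup_infoSeq hT J).length_le_card
  simp at this
  omega

theorem chanceFrom_nonneg (t : List A) : ∀ h, h ++ t ∈ T.hist → 0 ≤ T.chanceFrom h t := by
  induction t with
  | nil => intro h _; simp [chanceFrom]
  | cons a t ih =>
    intro h hh
    rw [chanceFrom]
    have h1 : h ++ [a] ∈ T.hist := mem_hist_of_prefix ⟨t, by simp⟩ hh
    refine mul_nonneg ?_ (ih _ (by simpa using hh))
    split_ifs with hn
    · exact T.chance_nonneg h (T.parent_mem _ _ h1) hn a (mem_childActions.2 h1)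
    · exact zero_le_one

theorem chanceReach_nonneg {z : List A} (hz : z ∈ T.terminals) : 0 ≤ T.chanceReach z :=
  chanceFrom_nonneg _ _ (by simpa using mem_hist_of_mem_terminals hz)

end Sequences

/-! ### Weights of sequences; modifying and gluing strategies. -/

section Weights

variable {i : Player}

theorem Strategy.weight_nil (x : T.Strategy i) : x.weight [] = 1 := by simp [weight]

theorem Strategy.weight_cons (x : T.Strategy i) (J : Info i) (a : A) (s : List (Info i × A)) :
    x.weight ((J, a) :: s) = x.prob J a * x.weight s := by simp [weight]

theorem Strategy.weight_append (x : T.Strategy i) (s t : List (Info i × A)) :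
    x.weight (s ++ t) = x.weight s * x.weight t := by simp [weight]

theorem Strategy.weight_nonneg (x : T.Strategy i) (s : List (Info i × A)) : 0 ≤ x.weight s := by
  apply List.prod_nonneg
  intro r hr
  obtain ⟨m, _, rfl⟩ := List.mem_map.1 hr
  exact x.nonneg _ _

theorem Strategy.prob_le_one (x : T.Strategy i) (J : Info i) (a : A) : x.prob J a ≤ 1 := by
  by_cases ha : a ∈ T.acts i J
  · rw [← x.sum_one J]
    exact Finset.single_le_sum (fun b _ => x.nonneg J b) ha
  · rw [x.eq_zero J a ha]
    exact zero_le_one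

theorem Strategy.weight_le_one (x : T.Strategy i) (s : List (Info i × A)) : x.weight s ≤ 1 := by
  induction s with
  | nil => simp [weight]
  | cons m s ih =>
    rw [x.weight_cons]
    exact mul_le_one₀ (x.prob_le_one _ _) (x.weight_nonneg _) ih

theorem Strategy.weight_pos_iff (x : T.Strategy i) (s : List (Info i × A)) :
    0 < x.weight s ↔ ∀ m ∈ s, 0 < x.prob m.1 m.2 := by
  induction s with
  | nil => simp [weight]
  | cons m s ih =>
    obtain ⟨J, a⟩ := m
    rw [x.weight_cons, List.forall_mem_cons, ← ih]
    constructor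
    · intro h
      exact ⟨pos_of_mul_pos_left h (x.weight_nonneg _), pos_of_mul_pos_right h (x.nonneg _ _)⟩
    · exact fun h => mul_pos h.1 h.2

theorem Strategy.weight_congr {x y : T.Strategy i} {s : List (Info i × A)}
    (h : ∀ m ∈ s, x.prob m.1 m.2 = y.prob m.1 m.2) : x.weight s = y.weight s := by
  unfold weight
  rw [List.map_congr_left h]

/-- A strategy exists, since every information set has an action. -/
instance : Nonempty (T.Strategy i) := by
  classical
  choose a ha using fun J => T.acts_nonempty i J
  exact ⟨{ prob := fun J b => if b = a J then 1 else 0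
           nonneg := fun J b => by positivity
           eq_zero := fun J b hb => if_neg (by rintro rfl; exact hb (ha J))
           sum_one := fun J => by simp [ha] }⟩

open Classical in
/-- The strategy that agrees with `y` except that it takes action `a` at `I`. -/
def Strategy.play (y : T.Strategy i) (I : Info i) (a : A) (ha : a ∈ T.acts i I) :
    T.Strategy i where
  prob J b := if J = I then (if b = a then 1 else 0) else y.prob J b
  nonneg J b := by
    split_ifs
    exacts [zero_le_one, le_rfl, y.nonneg J b]
  eq_zero J b hb := by
    split_ifs with h1 h2
    · subst h1 h2; exact absurd ha hb
    · rfl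
    · exact y.eq_zero J b hb
  sum_one J := by
    by_cases h : J = I
    · subst h; simp [ha]
    · simp [h, y.sum_one J]

open Classical in
/-- The strategy that plays `Y I` at and below each information set `I` with parent sequence `p`,
and `base` elsewhere. -/
def Strategy.glue (p : List (Info i × A)) (Y : Info i → T.Strategy i) (base : T.Strategy i) :
    T.Strategy i where
  prob J := (if p <+: T.infoSeq J then
    Y ((((T.infoSeq J).drop p.length).map Prod.fst).headD J) else base).prob J
  nonneg J := Strategy.nonneg _ J
  eq_zero J := Strategy.eq_zero _ J
  sum_one J := Strategy.sum_one _ J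

theorem Strategy.glue_weight (hT : T.PerfectRecall) {p : List (Info i × A)}
    {Y : Info i → T.Strategy i} {base : T.Strategy i} {I : Info i} {a : A}
    {t : List (Info i × A)} {h : List A} (hh : h ∈ T.hist)
    (hs : T.seq i h = p ++ (I, a) :: t) :
    (Strategy.glue p Y base).weight ((I, a) :: t) = (Y I).weight ((I, a) :: t) := by
  apply Strategy.weight_congr
  rintro ⟨J, b⟩ hm
  obtain ⟨t₁, t₂, ht⟩ := List.append_of_mem hm
  have hJ : T.infoSeq J = p ++ t₁ :=
    (infoSeq_of_seq_eq hT hh (J := J) (a := b) (s := p ++ t₁) (t := t₂) (by rw [hs, ht]; simp)).1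
  -- The first information set after `p` decides which `Y` is played, and it is `I` for every move
  -- of the tail.
  have hd : (((T.infoSeq J).drop p.length).map Prod.fst).headD J = I := by
    rw [hJ, List.drop_left]
    cases t₁ with
    | nil => simp only [List.nil_append, List.cons.injEq, Prod.mk.injEq] at ht; simp [ht.1.1]
    | cons m t₁ => simp only [List.cons_append, List.cons.injEq] at ht; simp [← ht.1]
  rw [hJ] at hd
  simp only [glue, hJ, List.prefix_append, if_true, hd]

theorem Strategy.play_weight_of_prefix (hT : T.PerfectRecall) (y : T.Strategy i) {I : Info i}
    {a : A} (ha : a ∈ T.acts i I) {b : A} {t : List (Info i × A)} {h : List A} (hh : h ∈ T.hist)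
    (hs : T.seq i h = T.actSeq I b ++ t) : (y.play I a ha).weight t = y.weight t := by
  apply Strategy.weight_congr
  rintro ⟨J, c⟩ hm
  obtain ⟨t₁, t₂, rfl⟩ := List.append_of_mem hm
  have hJ := (infoSeq_of_seq_eq hT hh (J := J) (a := c) (s := T.actSeq I b ++ t₁) (t := t₂)
    (by rw [hs]; simp)).1
  -- The parent sequence of `J` already contains a move at `I`, hence is longer than that of `I`.
  have : J ≠ I := by
    rintro rfl
    have := congrArg List.length hJ
    simp [actSeq] at this
  simp [play, this]

end Weights

end GameTree

/-! ### Recursive decomposition of expectations in sequence form. -/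

namespace GameTree

variable {A : Type u} {Info : Player → Type v} {T : GameTree A Info}

section Sums

variable {j : Player}

open Classical in
/-- The sum of `g` over the terminal nodes that lie at or after the sequence `p`, weighted with
the moves of `y` after `p`. -/
def seqSum (g : List A → ℝ) (y : T.Strategy j) (p : List (Info j × A)) : ℝ :=
  ∑ z ∈ T.terminals, if p <+: T.seq j z then g z * y.weight ((T.seq j z).drop p.length) else 0

open Classical in
/-- The sum of `g` over the terminal nodes that lie after the information set `I`, weighted with
the moves of `y` from `I` on. -/
def infoSum (g : List A → ℝ) (y : T.Strategy j) (I : Info j) : ℝ :=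
  ∑ z ∈ T.terminals, if ∃ a, T.actSeq I a <+: T.seq j z then
    g z * y.weight ((T.seq j z).drop (T.infoSeq I).length) else 0

open Classical in
/-- The sum of `g` over the terminal nodes with sequence exactly `p`. -/
def leafSum (T : GameTree A Info) (g : List A → ℝ) (p : List (Info j × A)) : ℝ :=
  ∑ z ∈ T.terminals, if T.seq j z = p then g z else 0

theorem actSeq_injective {I : Info j} {a b : A} {s : List (Info j × A)}
    (ha : T.actSeq I a <+: s) (hb : T.actSeq I b <+: s) : a = b := by
  have := (List.prefix_of_prefix_length_le ha hb (by simp [actSeq])).eq_of_length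
    (by simp [actSeq])
  simpa [actSeq] using this

theorem drop_of_actSeq_prefix {I : Info j} {a : A} {s t : List (Info j × A)}
    (h : T.actSeq I a ++ t = s) : s.drop (T.infoSeq I).length = (I, a) :: t := by
  subst h
  simp [actSeq]

theorem drop_actSeq_of_prefix {I : Info j} {a : A} {s t : List (Info j × A)}
    (h : T.actSeq I a ++ t = s) : s.drop (T.actSeq I a).length = t := by
  subst h
  simp

theorem mem_acts_of_actSeq_prefix (hT : T.PerfectRecall) {I : Info j} {a : A} {h : List A}
    (hh : h ∈ T.hist) (hp : T.actSeq I a <+: T.seq j h) : a ∈ T.acts j I := by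
  obtain ⟨t, ht⟩ := hp
  exact (infoSeq_of_seq_eq hT hh (J := I) (a := a) (s := T.infoSeq I) (t := t)
    (by rw [← ht]; simp [actSeq])).2

theorem infoSum_eq (hT : T.PerfectRecall) (g : List A → ℝ) (y : T.Strategy j) (I : Info j) :
    infoSum g y I = ∑ a ∈ T.acts j I, y.prob I a * seqSum g y (T.actSeq I a) := by
  classical
  unfold infoSum seqSum
  simp_rw [Finset.mul_sum]
  rw [Finset.sum_comm]
  refine Finset.sum_congr rfl fun z hz => ?_
  split_ifs with h
  · obtain ⟨a, t, ht⟩ := h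
    rw [Finset.sum_eq_single_of_mem a
      (mem_acts_of_actSeq_prefix hT (mem_hist_of_mem_terminals hz) ⟨t, ht⟩)]
    · rw [if_pos ⟨t, ht⟩, drop_of_actSeq_prefix ht, drop_actSeq_of_prefix ht, y.weight_cons]
      ring
    · intro b _ hb
      rw [if_neg fun h => hb (actSeq_injective h ⟨t, ht⟩), mul_zero]
  · refine (Finset.sum_eq_zero fun a _ => ?_).symm
    rw [if_neg fun h' => h ⟨a, h'⟩, mul_zero]

-- With `infoSum_eq` this is the dynamic programming recursion: by perfect recall, a terminal
-- sequence extending `p` either is `p` or continues through exactly one information set with parent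
-- sequence `p`.
open Classical in
theorem seqSum_eq [Fintype (Info j)] (hT : T.PerfectRecall) (g : List A → ℝ) (y : T.Strategy j)
    (p : List (Info j × A)) :
    seqSum g y p = T.leafSum g p + ∑ I : Info j, if T.infoSeq I = p then infoSum g y I else 0 := by
  have h1 : (∑ I : Info j, if T.infoSeq I = p then infoSum g y I else 0) =
      ∑ z ∈ T.terminals, ∑ I : Info j, if T.infoSeq I = p then
        (if ∃ a, T.actSeq I a <+: T.seq j z then
          g z * y.weight ((T.seq j z).drop (T.infoSeq I).length) else 0) else 0 := by
    rw [Finset.sum_comm]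
    refine Finset.sum_congr rfl fun I _ => ?_
    split_ifs
    · rfl
    · simp
  rw [h1]
  unfold seqSum leafSum
  rw [← Finset.sum_add_distrib]
  refine Finset.sum_congr rfl fun z hz => ?_
  have hz' := mem_hist_of_mem_terminals hz
  by_cases hp : p <+: T.seq j z
  · rw [if_pos hp]
    obtain ⟨t, ht⟩ := hp
    rcases t with _ | ⟨⟨I, a⟩, t⟩
    · rw [List.append_nil] at ht
      rw [if_pos ht.symm, Finset.sum_eq_zero, ← ht]
      · simp [Strategy.weight_nil]
      · intro I _
        rw [ite_eq_right_iff]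
        rintro rfl
        rw [if_neg]
        rintro ⟨a, ha⟩
        have := ha.length_le
        rw [← ht] at this
        simp [actSeq] at this
    · have hI := (infoSeq_of_seq_eq hT hz' ht.symm).1
      have hIa : T.actSeq I a ++ t = T.seq j z := by rw [← ht]; simp [actSeq, hI]
      rw [if_neg, Finset.sum_eq_single I, if_pos hI, if_pos ⟨a, t, hIa⟩, zero_add, hI]
      · intro J _ hJ
        rw [ite_eq_right_iff]
        rintro hJp
        rw [if_neg]
        rintro ⟨b, t', hb⟩
        rw [← hb, actSeq, hJp, List.append_assoc] at ht
        have := List.append_cancel_left ht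
        simp only [List.cons_append, List.cons.injEq, Prod.mk.injEq] at this
        exact hJ this.1.1.symm
      · simp
      · rw [← ht]; simp
  · rw [if_neg hp, if_neg, Finset.sum_eq_zero, add_zero]
    · intro I _
      rw [ite_eq_right_iff]
      rintro rfl
      rw [if_neg]
      rintro ⟨a, ha⟩
      exact hp (.trans (List.prefix_append _ _) ha)
    · rintro rfl
      exact hp (List.prefix_refl _)

theorem infoSum_glue (hT : T.PerfectRecall) (g : List A → ℝ) {Y : Info j → T.Strategy j}
    {base : T.Strategy j} (I : Info j) :
    infoSum g (Strategy.glue (T.infoSeq I) Y base) I = infoSum g (Y I) I := by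
  classical
  unfold infoSum
  refine Finset.sum_congr rfl fun z hz => ?_
  split_ifs with h
  · obtain ⟨a, t, ht⟩ := h
    rw [drop_of_actSeq_prefix ht, Strategy.glue_weight hT (mem_hist_of_mem_terminals hz)]
    rw [← ht]; simp [actSeq]
  · rfl

open Classical in
theorem seqSum_glue [Fintype (Info j)] (hT : T.PerfectRecall) (g : List A → ℝ)
    {p : List (Info j × A)} {Y : Info j → T.Strategy j} {base : T.Strategy j} :
    seqSum g (Strategy.glue p Y base) p =
      T.leafSum g p + ∑ I : Info j, if T.infoSeq I = p then infoSum g (Y I) I else 0 := by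
  rw [seqSum_eq hT]
  congr 1
  refine Finset.sum_congr rfl fun I _ => ?_
  split_ifs with h
  · subst h; rw [infoSum_glue hT]
  · rfl

theorem infoSum_play (hT : T.PerfectRecall) (g : List A → ℝ) (y : T.Strategy j) {I : Info j}
    {a : A} (ha : a ∈ T.acts j I) :
    infoSum g (y.play I a ha) I = seqSum g y (T.actSeq I a) := by
  classical
  rw [infoSum_eq hT, Finset.sum_eq_single_of_mem a ha]
  · simp only [Strategy.play, if_true, one_mul]
    unfold seqSum
    refine Finset.sum_congr rfl fun z hz => ?_
    split_ifs with h
    · obtain ⟨t, ht⟩ := h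
      rw [drop_actSeq_of_prefix ht]
      rw [← Strategy.play_weight_of_prefix hT y ha (mem_hist_of_mem_terminals hz) ht.symm]
      rfl
    · rfl
  · intro b _ hb
    simp [Strategy.play, hb]

end Sums

end GameTree

/-! ### Expectations of utilities that may be $+\infty$ but not $-\infty$. -/

section EReal

theorem sum_coe_mul_eq_coe {ι : Type*} {S : Finset ι} {r : ι → ℝ} {w : ι → EReal}
    (hr : ∀ z ∈ S, 0 ≤ r z) (hw : ∀ z ∈ S, ⊥ < w z) (h : ∀ z ∈ S, 0 < r z → w z ≠ ⊤) :
    ∑ z ∈ S, (r z : EReal) * w z = ((∑ z ∈ S, r z * (w z).toReal : ℝ) : EReal) := by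
  induction S using Finset.cons_induction with
  | empty => simp
  | cons a S ha ih =>
    rw [Finset.sum_cons, Finset.sum_cons, EReal.coe_add, ih
      (fun z hz => hr z (Finset.mem_cons_of_mem hz)) (fun z hz => hw z (Finset.mem_cons_of_mem hz))
      (fun z hz => h z (Finset.mem_cons_of_mem hz))]
    congr 1
    have hm : a ∈ Finset.cons a S ha := Finset.mem_cons_self a S
    rcases (hr a hm).eq_or_lt with h0 | h0
    · simp [← h0]
    · rw [EReal.coe_mul, EReal.coe_toReal (h a hm h0) (hw a hm).ne']

theorem bot_lt_coe_mul {r : ℝ} (hr : 0 ≤ r) {w : EReal} (hw : ⊥ < w) : ⊥ < (r : EReal) * w := by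
  rcases hr.eq_or_lt with h0 | h0
  · simp [← h0]
  · induction w with
    | bot => exact absurd hw (lt_irrefl _)
    | coe w => rw [← EReal.coe_mul]; exact EReal.bot_lt_coe _
    | top => rw [EReal.coe_mul_top_of_pos h0]; exact bot_lt_top

theorem bot_lt_sum_coe_mul {ι : Type*} {S : Finset ι} {r : ι → ℝ} {w : ι → EReal}
    (hr : ∀ z ∈ S, 0 ≤ r z) (hw : ∀ z ∈ S, ⊥ < w z) : ⊥ < ∑ z ∈ S, (r z : EReal) * w z := by
  induction S using Finset.cons_induction with
  | empty => simp
  | cons a S ha ih =>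
    rw [Finset.sum_cons]
    exact EReal.bot_lt_add_iff.2 ⟨bot_lt_coe_mul (hr a (Finset.mem_cons_self a S))
      (hw a (Finset.mem_cons_self a S)), ih (fun z hz => hr z (Finset.mem_cons_of_mem hz))
      (fun z hz => hw z (Finset.mem_cons_of_mem hz))⟩

/-- No summand is `⊥`, so a summand `⊤` cannot be absorbed by the others. -/
theorem ne_top_of_sum_coe_mul_ne_top {ι : Type*} {S : Finset ι} {r : ι → ℝ} {w : ι → EReal}
    (hr : ∀ z ∈ S, 0 ≤ r z) (hw : ∀ z ∈ S, ⊥ < w z) (h : ∑ z ∈ S, (r z : EReal) * w z ≠ ⊤)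
    {z : ι} (hz : z ∈ S) (hrz : 0 < r z) : w z ≠ ⊤ := by
  classical
  rintro hwz
  apply h
  rw [← Finset.add_sum_erase S _ hz, hwz, EReal.coe_mul_top_of_pos hrz]
  exact EReal.top_add_of_ne_bot (bot_lt_sum_coe_mul
    (fun z hz => hr z (Finset.mem_of_mem_erase hz))
    (fun z hz => hw z (Finset.mem_of_mem_erase hz))).ne'

end EReal

/-! ### Real-valued forms of the values used by the correction. -/

namespace Pseudogame

open GameTree

variable {A : Type u} {Info : Player → Type v} (G : Pseudogame A Info)

/-- What the terminal node `z` contributes to the expected upper bound of player `i`, apart from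
the weight of the opponent's moves; infinite bounds count as `0`. -/
def coef (i : Player) (x : G.Strat i) (z : List A) : ℝ :=
  G.chanceReach z * x.weight (G.seq i z) * (G.upper i z).toReal

variable {G} {i : Player}

theorem reach_nonneg (x : G.Strat i) (y : G.Strat i.opp) {z : List A} (hz : z ∈ G.terminals) :
    0 ≤ reach i x y z :=
  mul_nonneg (mul_nonneg (chanceReach_nonneg hz) (x.weight_nonneg _)) (y.weight_nonneg _)

theorem value_eq_coe {x : G.Strat i} {y : G.Strat i.opp}
    (h : ∀ z ∈ G.terminals, 0 < reach i x y z → G.upper i z ≠ ⊤) :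
    value (G.upper i) i x y = (seqSum (G.coef i x) y [] : ℝ) := by
  unfold value
  rw [sum_coe_mul_eq_coe (fun _ hz => reach_nonneg x y hz) (fun z hz => G.bot_lt_upper i z hz) h]
  congr 1
  refine Finset.sum_congr rfl fun z _ => ?_
  simp only [reach, coef, List.nil_prefix, if_true, List.length_nil, List.drop_zero]
  ring

theorem ne_top_of_value_ne_top {x : G.Strat i} {y : G.Strat i.opp}
    (h : value (G.upper i) i x y ≠ ⊤) {z : List A} (hz : z ∈ G.terminals)
    (hr : 0 < reach i x y z) : G.upper i z ≠ ⊤ :=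
  ne_top_of_sum_coe_mul_ne_top (fun _ hz => reach_nonneg x y hz)
    (fun z hz => G.bot_lt_upper i z hz) h hz hr

theorem bot_lt_value (x : G.Strat i) (y : G.Strat i.opp) : ⊥ < value (G.upper i) i x y :=
  bot_lt_sum_coe_mul (fun _ hz => reach_nonneg x y hz) (fun z hz => G.bot_lt_upper i z hz)

theorem Avoids.ne_top {x : G.Strat i} {y : G.Strat i.opp} (hy : G.Avoids i y) {z : List A}
    (hz : z ∈ G.terminals) (hr : 0 < reach i x y z) : G.upper i z ≠ ⊤ := by
  intro h
  have hc : 0 < G.chanceReach z := by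
    refine (chanceReach_nonneg hz).lt_of_ne fun h0 => ?_
    simp [reach, ← h0] at hr
  rw [reach, hy _ ⟨z, hz, rfl, hc, h⟩, mul_zero] at hr
  exact lt_irrefl _ hr

theorem avoidValue_le (x : G.Strat i) {y : G.Strat i.opp} (hy : G.Avoids i y) :
    G.avoidValue i x ≤ (seqSum (G.coef i x) y [] : ℝ) := by
  rw [← value_eq_coe fun z hz hr => hy.ne_top hz hr]
  exact iInf_le (fun y : {y : G.Strat i.opp // G.Avoids i y} => value (G.upper i) i x y.1) ⟨y, hy⟩

theorem weight_product_nonneg (x : G.Strat i) (y : G.Strat i.opp) {z : List A}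
    (hz : z ∈ G.terminals) (s : List (Info i.opp × A)) :
    0 ≤ G.chanceReach z * x.weight (G.seq i z) * y.weight s :=
  mul_nonneg (mul_nonneg (chanceReach_nonneg hz) (x.weight_nonneg _)) (y.weight_nonneg _)

/-- Continuing with `y` after the sequence `s` (with the product of the moves of `y` after `s`
given by dropping `n` moves) never meets an infinite upper bound. -/
def FiniteAfter (x : G.Strat i) (y : G.Strat i.opp) (p : List (Info i.opp × A)) (n : ℕ) : Prop :=
  ∀ z ∈ G.terminals, p <+: G.seq i.opp z → 0 < G.chanceReach z → 0 < x.weight (G.seq i z) →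
    0 < y.weight ((G.seq i.opp z).drop n) → G.upper i z ≠ ⊤

theorem pos_of_weight_product_pos {x : G.Strat i} {y : G.Strat i.opp} {z : List A}
    (hz : z ∈ G.terminals) {s : List (Info i.opp × A)}
    (h : 0 < G.chanceReach z * x.weight (G.seq i z) * y.weight s) :
    0 < G.chanceReach z ∧ 0 < x.weight (G.seq i z) ∧ 0 < y.weight s := by
  have h1 := pos_of_mul_pos_left h (y.weight_nonneg _)
  exact ⟨pos_of_mul_pos_left h1 (x.weight_nonneg _), pos_of_mul_pos_right h1 (chanceReach_nonneg hz),
    pos_of_mul_pos_right h (mul_nonneg (chanceReach_nonneg hz) (x.weight_nonneg _))⟩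

open Classical in
theorem bestValue_sum_eq {x : G.Strat i} {y : G.Strat i.opp} {I : Info i.opp} {a : A}
    (h : FiniteAfter x y (G.actSeq I a) (G.actSeq I a).length) :
    (∑ z ∈ G.terminals.filter fun z => G.actSeq I a <+: G.seq i.opp z,
      ((G.chanceReach z * x.weight (G.seq i z) *
        y.weight ((G.seq i.opp z).drop (G.actSeq I a).length) : ℝ) : EReal) * G.upper i z) =
      (seqSum (G.coef i x) y (G.actSeq I a) : ℝ) := by
  rw [sum_coe_mul_eq_coe]
  · congr 1
    rw [Finset.sum_filter]
    refine Finset.sum_congr rfl fun z _ => ?_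
    simp only [coef]
    congr 1
    ring
  · exact fun z hz => weight_product_nonneg x y (Finset.mem_filter.1 hz).1 _
  · exact fun z hz => G.bot_lt_upper i z (Finset.mem_filter.1 hz).1
  · intro z hz hr
    obtain ⟨hz, hp⟩ := Finset.mem_filter.1 hz
    obtain ⟨h1, h2, h3⟩ := pos_of_weight_product_pos hz hr
    exact h z hz hp h1 h2 h3

theorem bestValue_le {x : G.Strat i} {y : G.Strat i.opp} {I : Info i.opp} {a : A}
    (h : FiniteAfter x y (G.actSeq I a) (G.actSeq I a).length) :
    G.bestValue x I a ≤ (seqSum (G.coef i x) y (G.actSeq I a) : ℝ) := by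
  rw [← bestValue_sum_eq h]
  unfold bestValue
  exact iInf_le _ y

/-- A continuation whose extended-real value is below `c` has value other than `⊤`, so it meets no
infinite bound and its value is a real sum. -/
theorem exists_of_bestValue_lt {x : G.Strat i} {I : Info i.opp} {a : A} {c : EReal}
    (hc : G.bestValue x I a < c) : ∃ y : G.Strat i.opp,
      FiniteAfter x y (G.actSeq I a) (G.actSeq I a).length ∧
        ((seqSum (G.coef i x) y (G.actSeq I a) : ℝ) : EReal) < c := by
  classical
  unfold bestValue at hc
  obtain ⟨y, hy⟩ := iInf_lt_iff.1 hc
  have h : FiniteAfter x y (G.actSeq I a) (G.actSeq I a).length := by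
    intro z hz hp h1 h2 h3
    refine ne_top_of_sum_coe_mul_ne_top
      (fun z hz => weight_product_nonneg x y (Finset.mem_filter.1 hz).1 _)
      (fun z hz => G.bot_lt_upper i z (Finset.mem_filter.1 hz).1) hy.ne_top
      (Finset.mem_filter.2 ⟨hz, hp⟩) ?_
    positivity
  exact ⟨y, h, by rwa [bestValue_sum_eq h] at hy⟩

open Classical in
theorem restrictedValue_sum_eq {x : G.Strat i} {y : G.Strat i.opp} {I : Info i.opp}
    (h : G.AvoidsFrom I y) :
    (∑ z ∈ G.terminals.filter fun z => ∃ a, G.actSeq I a <+: G.seq i.opp z,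
      ((G.chanceReach z * x.weight (G.seq i z) *
        y.weight ((G.seq i.opp z).drop (G.infoSeq I).length) : ℝ) : EReal) * G.upper i z) =
      (infoSum (G.coef i x) y I : ℝ) := by
  rw [sum_coe_mul_eq_coe]
  · congr 1
    rw [Finset.sum_filter]
    refine Finset.sum_congr rfl fun z _ => ?_
    simp only [coef]
    congr 1
    ring
  · exact fun z hz => weight_product_nonneg x y (Finset.mem_filter.1 hz).1 _
  · exact fun z hz => G.bot_lt_upper i z (Finset.mem_filter.1 hz).1
  · intro z hz hr htop
    obtain ⟨hz, hp⟩ := Finset.mem_filter.1 hz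
    obtain ⟨h1, h2, h3⟩ := pos_of_weight_product_pos hz hr
    exact h3.ne' (h _ ⟨z, hz, rfl, h1, htop⟩ hp)

theorem restrictedValue_le (x : G.Strat i) {y : G.Strat i.opp} {I : Info i.opp}
    (h : G.AvoidsFrom I y) :
    G.restrictedValue x I ≤ (infoSum (G.coef i x) y I : ℝ) := by
  rw [← restrictedValue_sum_eq h]
  unfold restrictedValue
  exact iInf_le_of_le ⟨y, h⟩ le_rfl

theorem exists_of_restrictedValue_lt {x : G.Strat i} {I : Info i.opp} {c : EReal}
    (hc : G.restrictedValue x I < c) : ∃ y : G.Strat i.opp, G.AvoidsFrom I y ∧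
      ((infoSum (G.coef i x) y I : ℝ) : EReal) < c := by
  unfold restrictedValue at hc
  obtain ⟨⟨y, hy⟩, hyc⟩ := iInf_lt_iff.1 hc
  exact ⟨y, hy, by rwa [restrictedValue_sum_eq hy] at hyc⟩

end Pseudogame

/-! ### From an equilibrium to a corrected optimistic profile. -/

namespace GameTree

variable {A : Type u} {Info : Player → Type v} {T : GameTree A Info} {i : Player}

/-- The strategy that takes each action with the same probability. -/
def Strategy.uniform (T : GameTree A Info) (i : Player) : T.Strategy i := by
  classical
  exact
  { prob := fun J a => if a ∈ T.acts i J then ((T.acts i J).card : ℝ)⁻¹ else 0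
    nonneg := fun J a => by positivity
    eq_zero := fun J a ha => if_neg ha
    sum_one := fun J => by
      rw [Finset.sum_congr rfl fun a ha => if_pos ha, Finset.sum_const, nsmul_eq_mul]
      exact mul_inv_cancel₀ (Nat.cast_ne_zero.2 (Finset.card_pos.2 (T.acts_nonempty i J)).ne') }

theorem Strategy.uniform_weight_pos (hT : T.PerfectRecall) {h : List A} (hh : h ∈ T.hist) :
    0 < (Strategy.uniform T i).weight (T.seq i h) := by
  classical
  rw [Strategy.weight_pos_iff]
  rintro ⟨J, a⟩ hm
  obtain ⟨s, t, hst⟩ := List.append_of_mem hm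
  have := (infoSeq_of_seq_eq hT hh hst).2
  have hc := Finset.card_pos.2 ⟨a, this⟩
  simp only [uniform, this, if_true]
  positivity

end GameTree

namespace Pseudogame

open GameTree

variable {A : Type u} {Info : Player → Type v} {G : Pseudogame A Info} {i : Player}

theorem seqSum_coef_nil (x : G.Strat i) (y : G.Strat i.opp) :
    seqSum (G.coef i x) y [] = ∑ z ∈ G.terminals, reach i x y z * (G.upper i z).toReal := by
  refine Finset.sum_congr rfl fun z _ => ?_
  simp only [reach, coef, List.nil_prefix, if_true, List.length_nil, List.drop_zero]
  ring

theorem value_eq_coe_sum {x : G.Strat i} {y : G.Strat i.opp}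
    (h : ∀ z ∈ G.terminals, 0 < reach i x y z → G.upper i z ≠ ⊤) :
    value (G.upper i) i x y = (∑ z ∈ G.terminals, reach i x y z * (G.upper i z).toReal : ℝ) := by
  rw [value_eq_coe h, seqSum_coef_nil]

theorem reach_swap (x : G.Strat .one) (y : G.Strat .two) (z : List A) :
    reach (T := G.toGameTree) .two y x z = reach .one x y z := by
  simp only [reach, Player.opp]
  ring

theorem neg_sum_coe_mul {ι : Type*} {S : Finset ι} {r : ι → ℝ} {w : ι → EReal}
    (hr : ∀ z ∈ S, 0 ≤ r z) (hw : ∀ z ∈ S, ⊥ < w z) :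
    -∑ z ∈ S, (r z : EReal) * w z = ∑ z ∈ S, (r z : EReal) * -w z := by
  induction S using Finset.cons_induction with
  | empty => simp
  | cons a S ha ih =>
    have hr' : ∀ z ∈ S, 0 ≤ r z := fun z hz => hr z (Finset.mem_cons_of_mem hz)
    have hw' : ∀ z ∈ S, ⊥ < w z := fun z hz => hw z (Finset.mem_cons_of_mem hz)
    rw [Finset.sum_cons, Finset.sum_cons, ← ih hr' hw', EReal.neg_add, mul_neg, sub_eq_add_neg]
    · exact Or.inl (bot_lt_coe_mul (hr a (Finset.mem_cons_self a S))
        (hw a (Finset.mem_cons_self a S))).ne'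
    · exact Or.inr (bot_lt_sum_coe_mul hr' hw').ne'

theorem value_lower_one (x : G.Strat .one) (y : G.Strat .two) :
    value (G.lower .one) .one x y = -value (T := G.toGameTree) (G.upper .two) .two y x := by
  unfold value
  rw [neg_sum_coe_mul (fun z hz => reach_nonneg (i := .two) y x hz)
    (fun z hz => G.bot_lt_upper _ z hz)]
  refine Finset.sum_congr rfl fun z hz => ?_
  rw [reach_swap, show G.lower .one z = - G.upper .two z from G.zero_sum .two z hz]

theorem value_lower_le_upper (x : G.Strat .one) (y : G.Strat .two) :
    value (G.lower .one) .one x y ≤ value (G.upper .one) .one x y :=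
  Finset.sum_le_sum fun z hz => mul_le_mul_of_nonneg_left (G.lower_le_upper _ z hz)
    (EReal.coe_nonneg.2 (reach_nonneg (i := .one) x y hz))

theorem not_pseudoterminal_iff {z : List A} (hz : z ∈ G.terminals) :
    ¬ G.Pseudoterminal z ↔ G.upper .one z = - G.upper .two z := by
  have h1 : G.lower .one z = - G.upper .two z := G.zero_sum .two z hz
  have h2 : G.lower .two z = - G.upper .one z := G.zero_sum .one z hz
  have h3 := G.lower_le_upper .one z hz
  unfold Pseudoterminal
  push Not
  constructor
  · intro h
    rw [← h1]
    exact le_antisymm (h hz .one) h3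
  · rintro h _ (_ | _)
    · rw [h1, h]
    · rw [h2, h, neg_neg]

theorem isNash_zero_iff (x : G.Strat .one) (y : G.Strat .two) :
    G.IsNash 0 x y ↔ G.upperBR y ≤ G.lowerBR x := by
  have h1 : G.lowerBR x ≠ ⊤ := by
    refine ((iInf_le _ y).trans_lt ?_).ne
    rw [value_lower_one, EReal.neg_lt_comm, EReal.neg_top]
    exact bot_lt_value (i := .two) y x
  have h2 : G.upperBR y ≠ ⊥ :=
    ((bot_lt_value (i := .one) x y).trans_le (le_iSup (fun x => value (G.upper .one) .one x y) x)).ne'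
  unfold IsNash
  generalize G.upperBR y = a at *
  generalize G.lowerBR x = b at *
  rw [EReal.sub_le_iff_le_add (Or.inr (by simp)) (Or.inl h1)]
  simp

/-- Against the uniform strategy, any bad sequence played with positive probability reaches a node
of bound `⊤`. -/
theorem avoids_of_forall_value_ne_top {y : G.Strat i.opp}
    (h : ∀ x, value (G.upper i) i x y ≠ ⊤) : G.Avoids i y := by
  rintro s ⟨z, hz, rfl, hc, htop⟩
  by_contra hne
  refine ne_top_of_value_ne_top (h (Strategy.uniform G.toGameTree i)) hz ?_ htop
  exact mul_pos (mul_pos hc (Strategy.uniform_weight_pos G.perfectRecall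
    (mem_hist_of_mem_terminals hz))) ((y.weight_nonneg _).lt_of_ne' hne)

theorem isOptimistic_of_saddle {x : G.Strat i} {y : G.Strat i.opp} {v : EReal}
    (hy : G.Avoids i y) (h1 : ∀ x', value (G.upper i) i x' y ≤ v)
    (h2 : ∀ y', v ≤ value (G.upper i) i x y') : G.IsOptimistic i x :=
  ⟨fun _ x' => (iInf_le (fun y : {y // G.Avoids i y} => value (G.upper i) i x' y.1) ⟨y, hy⟩).trans
    ((h1 x').trans (le_iInf fun y' => h2 y'.1)), fun h => absurd ⟨y, hy⟩ h⟩

/-- Otherwise the opponent could switch at the root information set `I` to `a` and a better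
continuation, leaving the rest of `y` alone, and so improve on a best response. -/
theorem not_bestValue_lt_of_saddle [Fintype (Info i.opp)] {x : G.Strat i} {y : G.Strat i.opp}
    (hy : G.Avoids i y) (h : ∀ y', value (G.upper i) i x y ≤ value (G.upper i) i x y')
    {I : Info i.opp} (hI : G.infoSeq I = []) {a : A} (ha : a ∈ G.acts i.opp I) :
    ¬ G.bestValue x I a < G.restrictedValue x I := by
  classical
  intro hlt
  have hT := G.perfectRecall
  have hyI : G.AvoidsFrom I y := fun s hs _ => by rw [hI]; exact hy s hs
  obtain ⟨y₁, hfin, hlt⟩ := exists_of_bestValue_lt (hlt.trans_le (restrictedValue_le x hyI))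
  rw [EReal.coe_lt_coe_iff] at hlt
  let Y : Info i.opp → G.Strat i.opp := fun J => if J = I then y₁.play I a ha else y
  let y' : G.Strat i.opp := Strategy.glue [] Y y
  have hfin' : ∀ z ∈ G.terminals, 0 < reach i x y' z → G.upper i z ≠ ⊤ := by
    intro z hz hr htop
    obtain ⟨hc, hx, hw⟩ := pos_of_weight_product_pos hz hr
    have hz' := mem_hist_of_mem_terminals hz
    -- If the empty sequence were bad, `y` could not avoid it, since its weight is 1.
    rcases hs : G.seq i.opp z with _ | ⟨⟨J, b⟩, t⟩
    · have := hy _ ⟨z, hz, hs, hc, htop⟩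
      simp [Strategy.weight_nil] at this
    · rw [hs, Strategy.glue_weight hT hz' (p := []) hs] at hw
      by_cases hJ : J = I
      · subst hJ
        simp only [Y, if_true] at hw
        rw [Strategy.weight_cons] at hw
        have hba : b = a := by
          by_contra hba
          simp [Strategy.play, hba] at hw
        subst hba
        have hs' : G.seq i.opp z = G.actSeq J b ++ t := by simp [hs, actSeq, hI]
        rw [Strategy.play_weight_of_prefix hT y₁ ha hz' hs'] at hw
        refine hfin z hz ⟨t, hs'.symm⟩ hc hx ?_ htop
        rw [drop_actSeq_of_prefix hs'.symm]
        exact pos_of_mul_pos_right hw (Strategy.nonneg _ _ _)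
      · simp only [Y, hJ, if_false] at hw
        exact hw.ne' (hy _ ⟨z, hz, hs, hc, htop⟩)
  have hle := h y'
  rw [value_eq_coe hfin', value_eq_coe fun z hz hr => hy.ne_top hz hr,
    EReal.coe_le_coe_iff] at hle
  refine hle.not_gt ?_
  rw [seqSum_glue hT, seqSum_eq hT _ y]
  refine add_lt_add_right (Finset.sum_lt_sum (fun J _ => ?_) ⟨I, Finset.mem_univ _, ?_⟩) _
  · by_cases hJ : J = I
    · subst hJ
      simp only [hI, if_true, Y, infoSum_play hT]
      exact hlt.le
    · simp [Y, hJ]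
  · simp only [hI, if_true, Y, infoSum_play hT]
    exact hlt

theorem foldl_eq_self {α β : Type*} {f : α → β → α} {x : α} :
    ∀ {l : List β}, (∀ b ∈ l, f x b = x) → l.foldl f x = x
  | [], _ => rfl
  | b :: l, h => by
    rw [List.foldl_cons, h b List.mem_cons_self]
    exact foldl_eq_self fun c hc => h c (List.mem_cons_of_mem _ hc)

/-- A loop order enumerates the information sets. -/
abbrev fintypeInfo {T : GameTree A Info} (o : T.LoopOrder) (i : Player) : Fintype (Info i) :=
  ⟨⟨o.infos i, o.infos_nodup i⟩, o.mem_infos i⟩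

theorem corrected_eq_self_of_saddle (o : G.toGameTree.LoopOrder) (ε : ℝ≥0) {x : G.Strat i}
    {y : G.Strat i.opp} (hy : G.Avoids i y)
    (h : ∀ y', value (G.upper i) i x y ≤ value (G.upper i) i x y') : G.corrected o ε x = x := by
  classical
  let _ := fintypeInfo o i.opp
  unfold corrected
  refine foldl_eq_self fun I hI => ?_
  have hI : G.infoSeq I = [] := by simpa using (List.mem_filter.1 hI).2
  cases (o.infos i.opp).length with
  | zero => rw [correct]
  | succ n =>
    rw [correct]
    refine foldl_eq_self fun a ha => if_neg ?_
    exact not_bestValue_lt_of_saddle hy h hI ((o.mem_acts _ _ _).1 ha)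

theorem exists_correctedOptimistic_of_isNash (o : G.toGameTree.LoopOrder) {x : G.Strat .one}
    {y : G.Strat .two} (h : G.IsNash 0 x y) :
    G.IsCorrectedOptimistic o (fun _ => x) (fun _ => y) ∧ G.NoPseudoterminalInSupport x y := by
  rw [isNash_zero_iff] at h
  have hU : ∀ x', value (G.upper .one) .one x' y ≤ G.upperBR y := fun x' =>
    le_iSup (fun x => value (G.upper .one) .one x y) x'
  have hL : ∀ y', G.lowerBR x ≤ value (G.lower .one) .one x y' := fun y' =>
    iInf_le (fun y => value (G.lower .one) .one x y) y'
  have h1 : ∀ y', G.upperBR y ≤ value (G.upper .one) .one x y' := fun y' =>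
    h.trans ((hL y').trans (value_lower_le_upper x y'))
  have h2 : ∀ y' : G.Strat .two, value (T := G.toGameTree) (G.upper .two) .two y' x ≤ -G.lowerBR x :=
    fun y' => by rw [EReal.le_neg, ← value_lower_one]; exact hL y'
  have h3 : ∀ x' : G.Strat .one, -G.lowerBR x ≤ value (T := G.toGameTree) (G.upper .two) .two y x' :=
    fun x' => by
      rw [EReal.neg_le, ← value_lower_one]
      exact (value_lower_le_upper x' y).trans ((hU x').trans h)
  have hlow : G.lowerBR x < ⊤ := by
    refine (hL y).trans_lt ?_
    rw [value_lower_one, EReal.neg_lt_comm, EReal.neg_top]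
    exact bot_lt_value (i := .two) y x
  have hbot : ⊥ < G.lowerBR x := (bot_lt_value (i := .one) x y).trans_le ((hU x).trans h)
  have hy : G.Avoids .one y := avoids_of_forall_value_ne_top fun x' =>
    ((hU x').trans_lt (h.trans_lt hlow)).ne
  have hx : G.Avoids .two x := avoids_of_forall_value_ne_top (i := .two) fun y' =>
    ((h2 y').trans_lt (by rwa [EReal.neg_lt_comm, EReal.neg_top])).ne
  refine ⟨⟨x, y, isOptimistic_of_saddle hy hU h1, isOptimistic_of_saddle (i := .two) hx h2 h3,
    fun ε => (corrected_eq_self_of_saddle o ε hy fun y' => (hU x).trans (h1 y')).symm,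
    fun ε => (corrected_eq_self_of_saddle (i := .two) o ε hx
      fun x' => (h2 y).trans (h3 x')).symm⟩, ?_⟩
  have hle := (hU x).trans (h.trans (hL y))
  have hfy : ∀ z ∈ G.terminals, 0 < reach .one x y z → G.upper .one z ≠ ⊤ :=
    fun z hz hr => hy.ne_top hz hr
  have hfx : ∀ z ∈ G.terminals, 0 < reach (T := G.toGameTree) .two y x z → G.upper .two z ≠ ⊤ :=
    fun z hz hr => Avoids.ne_top (i := .two) hx hz hr
  rw [value_lower_one, value_eq_coe_sum (i := .one) hfy, value_eq_coe_sum (i := .two) hfx, ← EReal.coe_neg,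
    EReal.coe_le_coe_iff, le_neg_iff_add_nonpos_right,
    ← Finset.sum_add_distrib] at hle
  -- Each term is the reach probability times the gap between the bounds. The sum is at most zero
  -- and the terms are nonnegative, so all of them vanish.
  have hnn : ∀ z ∈ G.terminals, 0 ≤ reach .one x y z * (G.upper .one z).toReal +
      reach (T := G.toGameTree) .two y x z * (G.upper .two z).toReal ∧
      (0 < reach .one x y z * (G.upper .one z).toReal +
      reach (T := G.toGameTree) .two y x z * (G.upper .two z).toReal ∨
      (0 < reach .one x y z → G.upper .one z = - G.upper .two z)) := by
    intro z hz
    rw [reach_swap, ← mul_add]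
    rcases (reach_nonneg (i := .one) x y hz).eq_or_lt with h0 | h0
    · simp [← h0]
    · have hle := G.lower_le_upper .one z hz
      rw [show G.lower .one z = - G.upper .two z from G.zero_sum .two z hz] at hle
      have e1 := EReal.coe_toReal (hfy z hz h0) (G.bot_lt_upper _ z hz).ne'
      have e2 := EReal.coe_toReal (hfx z hz (by rwa [reach_swap])) (G.bot_lt_upper _ z hz).ne'
      rw [← e1, ← e2, ← EReal.coe_neg, EReal.coe_le_coe_iff] at hle
      refine ⟨mul_nonneg h0.le (by linarith), ?_⟩
      rcases hle.eq_or_lt with h4 | h4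
      · right
        intro _
        rw [← e1, ← e2, ← h4, EReal.coe_neg]
      · left
        exact mul_pos h0 (by linarith)
  intro z hz hr
  have hz0 := (Finset.sum_eq_zero_iff_of_nonneg fun z hz => (hnn z hz).1).1
    (le_antisymm hle (Finset.sum_nonneg fun z hz => (hnn z hz).1)) z hz.1
  refine (not_pseudoterminal_iff hz.1).2 ?_ hz
  exact ((hnn z hz.1).2.resolve_left hz0.not_gt) hr

end Pseudogame

/-! ### The minimax theorem on realization vectors. -/

namespace GameTree

variable {A : Type u} {Info : Player → Type v} {T : GameTree A Info} {i : Player}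

/-- The behavior strategy that realizes the convex combination of two strategies. -/
def Strategy.mix (x y : T.Strategy i) (a b : ℝ) (ha : 0 ≤ a) (hb : 0 ≤ b) : T.Strategy i := by
  classical
  exact
  { prob := fun J c =>
      if a * x.weight (T.infoSeq J) + b * y.weight (T.infoSeq J) = 0 then x.prob J c else
        (a * x.weight (T.infoSeq J) * x.prob J c + b * y.weight (T.infoSeq J) * y.prob J c) /
          (a * x.weight (T.infoSeq J) + b * y.weight (T.infoSeq J))
    nonneg := fun J c => by
      have h1 := x.weight_nonneg (T.infoSeq J)
      have h2 := y.weight_nonneg (T.infoSeq J)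
      have h3 := x.nonneg J c
      have h4 := y.nonneg J c
      split_ifs <;> positivity
    eq_zero := fun J c hc => by simp [x.eq_zero J c hc, y.eq_zero J c hc]
    sum_one := fun J => by
      split_ifs with h
      · exact x.sum_one J
      · rw [← Finset.sum_div, Finset.sum_add_distrib, ← Finset.mul_sum, ← Finset.mul_sum,
          x.sum_one, y.sum_one, mul_one, mul_one]
        exact div_self h }

/-- As in Kuhn's theorem, each local distribution is the average of the two, weighted by the
probabilities with which the strategies play towards `J`, so the denominators telescope along a
sequence. -/
theorem Strategy.mix_weight (hT : T.PerfectRecall) (x y : T.Strategy i) {a b : ℝ} (ha : 0 ≤ a)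
    (hb : 0 ≤ b) (hab : a + b = 1) {h : List A} (hh : h ∈ T.hist) :
    (x.mix y a b ha hb).weight (T.seq i h) = a * x.weight (T.seq i h) + b * y.weight (T.seq i h) := by
  induction h using List.reverseRecOn with
  | nil => simp [seq, seqFrom, weight_nil, hab]
  | append_singleton h c ih =>
    have hh' := T.parent_mem _ _ hh
    rw [seq_snoc]
    rcases T.ownMove_cases i h c with h0 | ⟨J, hJ, h1⟩
    · rw [h0, List.append_nil]
      exact ih hh'
    · have hs := T.infoSeq_eq hT ⟨hh', Finset.ne_empty_of_mem (mem_childActions.2 hh), hJ⟩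
      rw [h1]
      simp only [weight_append, ih hh', weight_cons, weight_nil, mul_one]
      rw [← hs]
      unfold mix
      dsimp only
      have hx := mul_nonneg ha (x.weight_nonneg (T.infoSeq J))
      have hy := mul_nonneg hb (y.weight_nonneg (T.infoSeq J))
      -- A zero denominator forces both nonnegative contributions to vanish, so the default
      -- distribution is irrelevant.
      split_ifs with hz
      · have h1 : a * x.weight (T.infoSeq J) = 0 := by linarith
        have h2 : b * y.weight (T.infoSeq J) = 0 := by linarith
        rw [hz, ← mul_assoc, ← mul_assoc, h1, h2]
        ring
      · rw [mul_div_cancel₀ _ hz]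
        ring

/-- The vector of the weights that a strategy gives to the sequences of the terminal nodes. -/
def Strategy.realization (x : T.Strategy i) (z : T.terminals) : ℝ := x.weight (T.seq i z)

theorem continuous_prod_prob (s : List (Info i × A)) :
    Continuous fun p : Info i → A → ℝ => (s.map fun m => p m.1 m.2).prod := by
  induction s with
  | nil => simpa using continuous_const
  | cons m s ih =>
    simp only [List.map_cons, List.prod_cons]
    exact ((continuous_apply_apply _ _).mul ih)

theorem isCompact_range_prob :
    IsCompact (Set.range fun x : T.Strategy i => x.prob) := by
  have hK : IsCompact (Set.univ.pi fun _ : Info i => Set.univ.pi fun _ : A => Set.Icc (0 : ℝ) 1) :=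
    isCompact_univ_pi fun _ => isCompact_univ_pi fun _ => isCompact_Icc
  have hC : IsClosed {p : Info i → A → ℝ | (∀ J a, 0 ≤ p J a) ∧
      (∀ J, ∀ a, a ∉ T.acts i J → p J a = 0) ∧ ∀ J, ∑ a ∈ T.acts i J, p J a = 1} := by
    simp only [Set.ofPred_and, Set.ofPred_forall]
    refine IsClosed.inter ?_ (IsClosed.inter ?_ ?_)
    · exact isClosed_iInter fun J => isClosed_iInter fun a =>
        isClosed_le continuous_const (continuous_apply_apply _ _)
    · exact isClosed_iInter fun J => isClosed_iInter fun a => isClosed_iInter fun _ =>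
        isClosed_eq (continuous_apply_apply _ _) continuous_const
    · exact isClosed_iInter fun J => isClosed_eq
        (continuous_finsetSum _ fun a _ => continuous_apply_apply _ _) continuous_const
  refine (hK.inter_right hC).of_isClosed_subset ?_ ?_
  · convert hC using 1
    ext p
    exact ⟨by rintro ⟨x, rfl⟩; exact ⟨x.nonneg, x.eq_zero, x.sum_one⟩,
      fun h => ⟨⟨p, h.1, h.2.1, h.2.2⟩, rfl⟩⟩
  · rintro _ ⟨x, rfl⟩
    exact ⟨fun J _ a _ => ⟨x.nonneg J a, x.prob_le_one J a⟩, x.nonneg, x.eq_zero, x.sum_one⟩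

/-- The strategies whose weight vanishes on the set `S` of sequences. -/
def Vanishing (T : GameTree A Info) (S : Set (List (Info i × A))) : Set (T.Strategy i) :=
  {x | ∀ s ∈ S, x.weight s = 0}

theorem isCompact_realization_image (S : Set (List (Info i × A))) :
    IsCompact (Strategy.realization '' T.Vanishing S) := by
  have hC : IsClosed {p : Info i → A → ℝ | ∀ s ∈ S, (s.map fun m => p m.1 m.2).prod = 0} := by
    simp only [Set.ofPred_forall]
    exact isClosed_iInter fun s => isClosed_iInter fun _ =>
      isClosed_eq (continuous_prod_prob s) continuous_const
  have hf : Continuous fun (p : Info i → A → ℝ) (z : T.terminals) =>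
      ((T.seq i z).map fun m => p m.1 m.2).prod := continuous_pi fun z => continuous_prod_prob _
  convert ((isCompact_range_prob (T := T) (i := i)).inter_right hC).image hf using 1
  ext w
  constructor
  · rintro ⟨x, hx, rfl⟩
    exact ⟨x.prob, ⟨⟨x, rfl⟩, hx⟩, rfl⟩
  · rintro ⟨_, ⟨⟨x, rfl⟩, hx⟩, rfl⟩
    exact ⟨x, hx, rfl⟩

/-- Mixing is linear only on sequences of actual histories, hence the condition on `S`. -/
theorem convex_realization_image (hT : T.PerfectRecall) {S : Set (List (Info i × A))}
    (hS : ∀ s ∈ S, ∃ z ∈ T.terminals, T.seq i z = s) :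
    Convex ℝ (Strategy.realization '' T.Vanishing S) := by
  rintro _ ⟨x, hx, rfl⟩ _ ⟨y, hy, rfl⟩ a b ha hb hab
  refine ⟨x.mix y a b ha hb, fun s hs => ?_, ?_⟩
  · obtain ⟨z, hz, rfl⟩ := hS s hs
    rw [Strategy.mix_weight hT x y ha hb hab (mem_hist_of_mem_terminals hz), hx _ hs, hy _ hs]
    simp
  · ext z
    exact Strategy.mix_weight hT x y ha hb hab (mem_hist_of_mem_terminals z.2)

end GameTree

namespace Pseudogame

open GameTree

variable {A : Type u} {Info : Player → Type v} {G : Pseudogame A Info} {i : Player}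

/-- The opponent has an avoiding strategy that holds player `i` to the optimistic value. -/
theorem exists_avoids_forall_value_le (hA : G.Avoidable i) {x₀ : G.Strat i}
    (hx₀ : G.IsOptimistic i x₀) :
    ∃ y, G.Avoids i y ∧ ∀ x, value (G.upper i) i x y ≤ G.avoidValue i x₀ := by
  have hT := G.perfectRecall
  -- The payoff is not bilinear in behavior strategies but is in realization vectors. Replacing
  -- infinite bounds by 0 is harmless because the opponent's strategies are restricted to avoiding
  -- ones.
  let f : (G.terminals → ℝ) → (G.terminals → ℝ) → ℝ := fun q p =>
    ∑ z : G.terminals, G.chanceReach z * (G.upper i z).toReal * p z * q z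
  let X : Set (G.terminals → ℝ) :=
    Strategy.realization '' G.toGameTree.Vanishing (i := i.opp) {s | G.Bad i s}
  let Y : Set (G.terminals → ℝ) :=
    Strategy.realization '' G.toGameTree.Vanishing (i := i) ∅
  have hf : ∀ (x : G.Strat i) (y : G.Strat i.opp), G.Avoids i y →
      value (G.upper i) i x y = (f y.realization x.realization : ℝ) := by
    intro x y hy
    rw [value_eq_coe_sum fun z hz hr => hy.ne_top hz hr, ← Finset.sum_coe_sort]
    congr 1
    refine Finset.sum_congr rfl fun z _ => ?_
    simp only [reach, Strategy.realization]
    ring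
  have hq : ∀ p a b (q q' : G.terminals → ℝ), f (a • q + b • q') p = a * f q p + b * f q' p := by
    intro p a b q q'
    simp only [f, Finset.mul_sum, ← Finset.sum_add_distrib]
    refine Finset.sum_congr rfl fun z _ => ?_
    simp only [Pi.add_apply, Pi.smul_apply, smul_eq_mul]
    ring
  have hp : ∀ q a b (p p' : G.terminals → ℝ), f q (a • p + b • p') = a * f q p + b * f q p' := by
    intro q a b p p'
    simp only [f, Finset.mul_sum, ← Finset.sum_add_distrib]
    refine Finset.sum_congr rfl fun z _ => ?_
    simp only [Pi.add_apply, Pi.smul_apply, smul_eq_mul]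
    ring
  have hcX : Convex ℝ X := convex_realization_image hT fun s ⟨z, hz, hs, _⟩ => ⟨z, hz, hs⟩
  have hcY : Convex ℝ Y := convex_realization_image hT fun s hs => absurd hs (Set.notMem_empty s)
  obtain ⟨y₀, hy₀⟩ := hA
  obtain ⟨_, ⟨y, hy, rfl⟩, _, ⟨x, -, rfl⟩, hs⟩ := Sion.exists_isSaddlePointOn (X := X) (Y := Y)
    (f := f) ⟨_, y₀, hy₀, rfl⟩ hcX (isCompact_realization_image _)
    (fun p _ => Continuous.continuousOn (by fun_prop) |>.lowerSemicontinuousOn)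
    (fun p _ => ConvexOn.quasiconvexOn
      ⟨hcX, fun q _ q' _ a b _ _ _ => (hq p a b q q').le⟩) hcY
    ⟨_, Classical.arbitrary (G.Strat i), fun s hs => absurd hs (Set.notMem_empty s), rfl⟩
    (isCompact_realization_image _)
    (fun q _ => Continuous.continuousOn (by fun_prop) |>.upperSemicontinuousOn)
    (fun q _ => ConcaveOn.quasiconcaveOn
      ⟨hcY, fun p _ p' _ a b _ _ _ => (hp q a b p p').ge⟩)
  refine ⟨y, hy, fun x' => le_trans ?_ (hx₀.1 ⟨y₀, hy₀⟩ x)⟩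
  refine le_iInf fun y' => ?_
  rw [hf x' y hy, hf x y'.1 y'.2, EReal.coe_le_coe_iff]
  exact hs _ ⟨y', y'.2, rfl⟩ _ ⟨x', fun s hs => absurd hs (Set.notMem_empty s), rfl⟩

end Pseudogame

/-! ### Small perturbations: support and Lipschitz estimates. -/

namespace GameTree

variable {A : Type u} {Info : Player → Type v} {T : GameTree A Info} {i : Player}

/-- The probabilities of two strategies differ by at most `δ`. -/
def Strategy.Close (δ : ℝ) (x x' : T.Strategy i) : Prop := ∀ J a, |x.prob J a - x'.prob J a| ≤ δ

/-- Every action that `x` takes with positive probability is taken by `x'` as well. -/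
def Strategy.SuppLE (x x' : T.Strategy i) : Prop := ∀ J a, 0 < x.prob J a → 0 < x'.prob J a

theorem Strategy.SuppLE.trans {x x' x'' : T.Strategy i} (h : x.SuppLE x') (h' : x'.SuppLE x'') :
    x.SuppLE x'' := fun J a hx => h' J a (h J a hx)

theorem Strategy.SuppLE.weight_pos {x x' : T.Strategy i} (h : x.SuppLE x')
    {s : List (Info i × A)} (hs : 0 < x.weight s) : 0 < x'.weight s :=
  (x'.weight_pos_iff s).2 fun m hm => h _ _ ((x.weight_pos_iff s).1 hs m hm)

theorem Strategy.Close.symm {δ : ℝ} {x x' : T.Strategy i} (h : x.Close δ x') : x'.Close δ x :=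
  fun J a => by rw [abs_sub_comm]; exact h J a

theorem Strategy.Close.trans {δ δ' : ℝ} {x x' x'' : T.Strategy i} (h : x.Close δ x')
    (h' : x'.Close δ' x'') : x.Close (δ + δ') x'' :=
  fun J a => (abs_sub_le _ _ _).trans (add_le_add (h J a) (h' J a))

theorem Strategy.Close.mono {δ δ' : ℝ} {x x' : T.Strategy i} (h : x.Close δ x') (hd : δ ≤ δ') :
    x.Close δ' x' := fun J a => (h J a).trans hd

theorem Strategy.Close.weight {δ : ℝ} {x x' : T.Strategy i} (h : x.Close δ x')
    (s : List (Info i × A)) : |x.weight s - x'.weight s| ≤ s.length * δ := by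
  induction s with
  | nil => simp [weight_nil]
  | cons m s ih =>
    obtain ⟨J, a⟩ := m
    rw [weight_cons, weight_cons]
    have e : x.prob J a * x.weight s - x'.prob J a * x'.weight s =
        x.prob J a * (x.weight s - x'.weight s) + (x.prob J a - x'.prob J a) * x'.weight s := by
      ring
    rw [e, List.length_cons, Nat.cast_add, Nat.cast_one, add_mul, one_mul]
    refine (abs_add_le _ _).trans (add_le_add ?_ ?_)
    · rw [abs_mul, abs_of_nonneg (x.nonneg J a)]
      exact (mul_le_of_le_one_left (abs_nonneg _) (x.prob_le_one J a)).trans ih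
    · rw [abs_mul, abs_of_nonneg (x'.weight_nonneg s)]
      exact (mul_le_of_le_one_right (abs_nonneg _) (x'.weight_le_one s)).trans (h J a)

/-- `x'` arises from `x` by moving mass of order `K ε`, without losing support. -/
def Strategy.Step (K : ℝ) (ε : ℝ≥0) (x x' : T.Strategy i) : Prop := x.SuppLE x' ∧ x.Close (K * ε) x'

theorem Strategy.Step.refl (ε : ℝ≥0) (x : T.Strategy i) : x.Step 0 ε x :=
  ⟨fun _ _ => id, fun J a => by simp⟩

theorem Strategy.Step.trans {K K' : ℝ} {ε : ℝ≥0} {x x' x'' : T.Strategy i} (h : x.Step K ε x')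
    (h' : x'.Step K' ε x'') : x.Step (K + K') ε x'' :=
  ⟨h.1.trans h'.1, by rw [add_mul]; exact h.2.trans h'.2⟩

theorem Strategy.Step.mono {K K' : ℝ} {ε : ℝ≥0} {x x' : T.Strategy i} (h : x.Step K ε x')
    (hK : K ≤ K') : x.Step K' ε x' :=
  ⟨h.1, h.2.mono (mul_le_mul_of_nonneg_right hK ε.2)⟩

/-- The constant is the sum of those of the single steps, uniformly in `ε` and `x`. The intermediate
`w` is the strategy at the moment `b` is processed; later steps keep the support then obtained. -/
theorem Strategy.exists_foldl_step {β : Type*} {f : ℝ≥0 → T.Strategy i → β → T.Strategy i}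
    {l : List β} (hf : ∀ b ∈ l, ∃ K : ℝ, 0 ≤ K ∧ ∀ ε (x : T.Strategy i), x.Step K ε (f ε x b)) :
    ∃ K : ℝ, 0 ≤ K ∧ ∀ ε (x : T.Strategy i), x.Step K ε (l.foldl (f ε) x) ∧
      ∀ b ∈ l, ∃ w : T.Strategy i, x.Step K ε w ∧ (f ε w b).Step K ε (l.foldl (f ε) x) := by
  induction l with
  | nil => exact ⟨0, le_rfl, fun ε x => ⟨.refl ε x, by simp⟩⟩
  | cons c l ih =>
    obtain ⟨K, hK, h⟩ := ih fun b hb => hf b (List.mem_cons_of_mem _ hb)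
    obtain ⟨K', hK', h'⟩ := hf c List.mem_cons_self
    refine ⟨K' + K, add_nonneg hK' hK, fun ε x => ⟨(h' ε x).trans (h ε _).1, ?_⟩⟩
    intro b hb
    rcases List.mem_cons.1 hb with rfl | hb
    · exact ⟨x, (Step.refl ε x).mono (add_nonneg hK' hK),
        ((h ε _).1).mono (le_add_of_nonneg_left hK')⟩
    · obtain ⟨w, h1, h2⟩ := (h ε (f ε x c)).2 b hb
      exact ⟨w, (h' ε x).trans h1, h2.mono (le_add_of_nonneg_left hK')⟩

/-- If $e\le\varepsilon$ is added to $p$ and $E$ in total, then $p$ changes by $(pE-e)/(1+E)$, and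
$E$ is at most $\varepsilon$ times the number of actions. -/
theorem Strategy.addMass_step [Fintype (Info i)] (x : T.Strategy i)
    (S : Set (List (Info i × A))) (ε : ℝ≥0) :
    x.Step (1 + ∑ J, ((T.acts i J).card : ℝ)) ε (x.addMass S ε) := by
  classical
  have hE : ∀ J, 0 ≤ ∑ b ∈ T.acts i J, (if ∃ s ∈ S, (J, b) ∈ s then (ε : ℝ) else 0) :=
    fun J => Finset.sum_nonneg fun b _ => by split_ifs <;> simp
  constructor
  · intro J a h
    refine div_pos (add_pos_of_pos_of_nonneg h ?_) (by linarith [hE J])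
    split_ifs <;> simp
  · intro J a
    have hE' : ∑ b ∈ T.acts i J, (if ∃ s ∈ S, (J, b) ∈ s then (ε : ℝ) else 0) ≤
        (∑ J, ((T.acts i J).card : ℝ)) * ε := by
      refine (Finset.sum_le_card_nsmul _ _ (ε : ℝ) fun b _ => ?_).trans ?_
      · split_ifs <;> simp
      · rw [nsmul_eq_mul]
        exact mul_le_mul_of_nonneg_right (Finset.single_le_sum
          (f := fun J => ((T.acts i J).card : ℝ)) (fun J _ => Nat.cast_nonneg _)
          (Finset.mem_univ J)) ε.2
    have h1 := x.nonneg J a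
    have h2 := x.prob_le_one J a
    have hE0 := hE J
    obtain ⟨e, he, h3, h4⟩ : ∃ e, (x.addMass S ε).prob J a = (x.prob J a + e) /
        (1 + ∑ b ∈ T.acts i J, (if ∃ s ∈ S, (J, b) ∈ s then (ε : ℝ) else 0)) ∧ 0 ≤ e ∧ e ≤ ε := by
      refine ⟨_, rfl, ?_, ?_⟩ <;> split_ifs <;> simp
    rw [he]
    generalize ∑ b ∈ T.acts i J, (if ∃ s ∈ S, (J, b) ∈ s then (ε : ℝ) else 0) = E at *
    have hd : (0 : ℝ) < 1 + E := by linarith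
    have hpE : x.prob J a * E ≤ E := mul_le_of_le_one_left hE0 h2
    have hpE0 : 0 ≤ x.prob J a * E := mul_nonneg h1 hE0
    have e1 : x.prob J a - (x.prob J a + e) / (1 + E) = (x.prob J a * E - e) / (1 + E) := by
      field_simp
      ring
    rw [e1, abs_div, abs_of_pos hd]
    refine (div_le_self (abs_nonneg _) (by linarith)).trans ?_
    rw [add_mul, one_mul, abs_le]
    constructor <;> linarith

theorem Strategy.addMass_weight_pos (hT : T.PerfectRecall) (x : T.Strategy i)
    {S : Set (List (Info i × A))} {ε : ℝ≥0} (hε : 0 < ε) {h : List A} (hh : h ∈ T.hist)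
    (hS : T.seq i h ∈ S) : 0 < (x.addMass S ε).weight (T.seq i h) := by
  classical
  rw [weight_pos_iff]
  rintro ⟨J, a⟩ hm
  obtain ⟨s, t, hst⟩ := List.append_of_mem hm
  have ha := (infoSeq_of_seq_eq hT hh hst).2
  have hE : 0 ≤ ∑ b ∈ T.acts i J, (if ∃ s ∈ S, (J, b) ∈ s then (ε : ℝ) else 0) :=
    Finset.sum_nonneg fun b _ => by split_ifs <;> simp
  refine div_pos (add_pos_of_nonneg_of_pos (x.nonneg J a) ?_) (by linarith)
  rw [if_pos ⟨ha, _, hS, hm⟩]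
  exact_mod_cast hε

end GameTree

namespace Pseudogame

open GameTree

variable {A : Type u} {Info : Player → Type v} {G : Pseudogame A Info} {i : Player}

variable (G i) in
/-- A Lipschitz constant of the expectations of the finite upper bounds. -/
def lipConst : ℝ :=
  ∑ z ∈ G.terminals, |G.chanceReach z * (G.upper i z).toReal| * (G.seq i z).length

theorem lipConst_nonneg : 0 ≤ G.lipConst i := Finset.sum_nonneg fun _ _ => by positivity

theorem sum_coef_le {δ : ℝ} {x x' : G.Strat i} (h : x.Close δ x') {φ : List A → ℝ}
    (h0 : ∀ z, 0 ≤ φ z) (h1 : ∀ z, φ z ≤ 1) :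
    ∑ z ∈ G.terminals, G.coef i x z * φ z ≤
      ∑ z ∈ G.terminals, G.coef i x' z * φ z + G.lipConst i * δ := by
  rw [lipConst, Finset.sum_mul, ← Finset.sum_add_distrib]
  refine Finset.sum_le_sum fun z _ => ?_
  rw [← sub_le_iff_le_add']
  have e : G.coef i x z * φ z - G.coef i x' z * φ z = (G.chanceReach z * (G.upper i z).toReal) *
      (x.weight (G.seq i z) - x'.weight (G.seq i z)) * φ z := by
    simp only [coef]
    ring
  rw [e]
  refine (le_abs_self _).trans ?_
  rw [abs_mul, abs_of_nonneg (h0 z)]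
  refine (mul_le_of_le_one_right (abs_nonneg _) (h1 z)).trans ?_
  rw [abs_mul, mul_assoc]
  exact mul_le_mul_of_nonneg_left (h.weight _) (abs_nonneg _)

theorem infoSum_coef_le {δ : ℝ} {x x' : G.Strat i} (h : x.Close δ x') (y : G.Strat i.opp)
    (I : Info i.opp) :
    infoSum (G.coef i x) y I ≤ infoSum (G.coef i x') y I + G.lipConst i * δ := by
  classical
  convert sum_coef_le h (φ := fun z => if ∃ a, G.actSeq I a <+: G.seq i.opp z then
    y.weight ((G.seq i.opp z).drop (G.infoSeq I).length) else 0) ?_ ?_ using 2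
  · exact Finset.sum_congr rfl fun z _ => by split_ifs <;> simp
  · exact Finset.sum_congr rfl fun z _ => by split_ifs <;> simp
  · intro z
    split_ifs
    exacts [y.weight_nonneg _, le_rfl]
  · intro z
    split_ifs
    exacts [y.weight_le_one _, zero_le_one]

theorem seqSum_coef_le {δ : ℝ} {x x' : G.Strat i} (h : x.Close δ x') (y : G.Strat i.opp)
    (p : List (Info i.opp × A)) :
    seqSum (G.coef i x) y p ≤ seqSum (G.coef i x') y p + G.lipConst i * δ := by
  classical
  convert sum_coef_le h (φ := fun z => if p <+: G.seq i.opp z then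
    y.weight ((G.seq i.opp z).drop p.length) else 0) ?_ ?_ using 2
  · exact Finset.sum_congr rfl fun z _ => by split_ifs <;> simp
  · exact Finset.sum_congr rfl fun z _ => by split_ifs <;> simp
  · intro z
    split_ifs
    exacts [y.weight_nonneg _, le_rfl]
  · intro z
    split_ifs
    exacts [y.weight_le_one _, zero_le_one]

theorem leafSum_coef_le {δ : ℝ} {x x' : G.Strat i} (h : x.Close δ x')
    (p : List (Info i.opp × A)) :
    G.leafSum (G.coef i x) p ≤ G.leafSum (G.coef i x') p + G.lipConst i * δ := by
  classical
  convert sum_coef_le h (φ := fun z => if G.seq i.opp z = p then 1 else 0) ?_ ?_ using 2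
  · exact Finset.sum_congr rfl fun z _ => by split_ifs <;> simp
  · exact Finset.sum_congr rfl fun z _ => by split_ifs <;> simp
  · intro z
    split_ifs
    exacts [zero_le_one, le_rfl]
  · intro z
    split_ifs
    exacts [le_rfl, zero_le_one]

open Classical in
/-- What the correction at `I` does for the action `a`. -/
def correctAction (o : G.toGameTree.LoopOrder) (ε : ℝ≥0) (n : ℕ) (I : Info i.opp)
    (x : G.Strat i) (a : A) : G.Strat i :=
  if G.bestValue x I a < G.restrictedValue x I then
    ((o.infos i.opp).filter fun I' => G.infoSeq I' = G.actSeq I a).foldl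
      (fun x I' => G.correct o ε n x I')
      (x.addMass {r | G.payoff i r (G.actSeq I a) = ⊤} ε)
  else x

theorem correct_succ (o : G.toGameTree.LoopOrder) (ε : ℝ≥0) (n : ℕ) (x : G.Strat i)
    (I : Info i.opp) :
    G.correct o ε (n + 1) x I = (o.acts i.opp I).foldl (G.correctAction o ε n I) x := by
  rw [correct]
  rfl

theorem exists_correctAction_step [Fintype (Info i)] (o : G.toGameTree.LoopOrder) {n : ℕ}
    (h : ∀ I : Info i.opp, ∃ K : ℝ, 0 ≤ K ∧ ∀ ε (x : G.Strat i), x.Step K ε (G.correct o ε n x I))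
    (I : Info i.opp) (a : A) :
    ∃ K : ℝ, 0 ≤ K ∧ ∀ ε (x : G.Strat i), x.Step K ε (G.correctAction o ε n I x a) := by
  classical
  obtain ⟨K, hK, h⟩ := Strategy.exists_foldl_step
    (f := fun ε (x : G.Strat i) I' => G.correct o ε n x I')
    (l := (o.infos i.opp).filter fun I' => G.infoSeq I' = G.actSeq I a) fun I' _ => h I'
  have hc : (0 : ℝ) ≤ 1 + ∑ J : Info i, ((G.acts i J).card : ℝ) := by positivity
  refine ⟨_, add_nonneg hc hK, fun ε x => ?_⟩
  unfold correctAction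
  split_ifs
  · exact (x.addMass_step _ ε).trans (h ε _).1
  · exact (Strategy.Step.refl ε x).mono (add_nonneg hc hK)

theorem exists_correct_step [Fintype (Info i)] (o : G.toGameTree.LoopOrder) (n : ℕ) :
    ∀ I : Info i.opp, ∃ K : ℝ, 0 ≤ K ∧
      ∀ ε (x : G.Strat i), x.Step K ε (G.correct o ε n x I) := by
  induction n with
  | zero => exact fun I => ⟨0, le_rfl, fun ε x => by rw [correct]; exact .refl ε x⟩
  | succ n ih =>
    intro I
    obtain ⟨K, hK, h⟩ := Strategy.exists_foldl_step (f := fun ε => G.correctAction o ε n I)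
      (l := o.acts i.opp I) fun a _ => exists_correctAction_step o ih I a
    refine ⟨K, hK, fun ε x => ?_⟩
    rw [correct_succ]
    exact (h ε x).1

end Pseudogame

/-! ### Effectiveness of the correction procedure. -/

namespace Pseudogame

open GameTree

variable {A : Type u} {Info : Player → Type v} {G : Pseudogame A Info} {i : Player}

theorem FiniteAfter.mono_prefix {x : G.Strat i} {y : G.Strat i.opp}
    {p q : List (Info i.opp × A)} {n : ℕ} (h : FiniteAfter x y p n) (hpq : p <+: q) :
    FiniteAfter x y q n := fun z hz hq => h z hz (hpq.trans hq)

theorem FiniteAfter.of_suppLE {x x' : G.Strat i} {y : G.Strat i.opp}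
    {p : List (Info i.opp × A)} {n : ℕ} (h : FiniteAfter x' y p n) (hx : x.SuppLE x') :
    FiniteAfter x y p n := fun z hz hp hc hw => h z hz hp hc (hx.weight_pos hw)

theorem FiniteAfter.of_prob_pos {x : G.Strat i} {y : G.Strat i.opp} {I : Info i.opp} {a : A}
    (h : FiniteAfter x y (G.actSeq I a) (G.infoSeq I).length) (ha : 0 < y.prob I a) :
    FiniteAfter x y (G.actSeq I a) (G.actSeq I a).length := by
  intro z hz hp hc hx hy
  refine h z hz hp hc hx ?_
  obtain ⟨t, ht⟩ := hp
  rw [drop_actSeq_of_prefix ht] at hy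
  rw [drop_of_actSeq_prefix ht, Strategy.weight_cons]
  exact mul_pos ha hy

theorem payoff_eq_top {z : List A} (hz : z ∈ G.terminals) (hc : 0 < G.chanceReach z)
    (htop : G.upper i z = ⊤) : G.payoff i (G.seq i z) (G.seq i.opp z) = ⊤ := by
  classical
  by_contra hne
  unfold payoff at hne
  exact ne_top_of_sum_coe_mul_ne_top (fun z hz => chanceReach_nonneg (Finset.mem_filter.1 hz).1)
    (fun z hz => G.bot_lt_upper i z (Finset.mem_filter.1 hz).1) hne
    (Finset.mem_filter.2 ⟨hz, rfl, rfl⟩) hc htop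

/-- Strategies that avoid the bad sequences from the information sets just below `I a` on combine
into one that avoids the bad sequences from `I` on. -/
theorem avoidsFrom_play_glue {I : Info i.opp} {a : A} (ha : a ∈ G.acts i.opp I)
    (hbad : ¬ G.Bad i (G.actSeq I a)) {Y : Info i.opp → G.Strat i.opp}
    (hY : ∀ J, G.infoSeq J = G.actSeq I a → G.AvoidsFrom J (Y J)) (base : G.Strat i.opp) :
    G.AvoidsFrom I ((Strategy.glue (G.actSeq I a) Y base).play I a ha) := by
  classical
  have hT := G.perfectRecall
  rintro s hs ⟨b, t, ht⟩
  rw [drop_of_actSeq_prefix ht, Strategy.weight_cons]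
  obtain ⟨z, hz, hzs, -⟩ := id hs
  have hz' := mem_hist_of_mem_terminals hz
  by_cases hb : b = a
  · subst hb
    rw [Strategy.play_weight_of_prefix hT _ ha hz' (hzs.trans ht.symm)]
    rcases t with _ | ⟨⟨J, c⟩, t⟩
    · rw [List.append_nil] at ht
      exact absurd (ht ▸ hs) hbad
    · have hJ := (infoSeq_of_seq_eq hT hz' (hzs.trans ht.symm)).1
      have hJc : G.actSeq J c ++ t = s := by rw [← ht, actSeq, hJ]; simp
      rw [Strategy.glue_weight hT hz' (hzs.trans ht.symm)]
      have := hY J hJ s hs ⟨c, t, hJc⟩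
      rw [drop_of_actSeq_prefix hJc] at this
      rw [this, mul_zero]
  · simp [Strategy.play, hb]

/-- What the final strategy `x'` yields against a continuation of the opponent that does not give
infinite payoffs is, up to order `ε`, at least what the original strategy `x₀` yields against some
continuation that avoids all bad sequences. -/
def CorrectedAt (G : Pseudogame A Info) {i : Player} (C : ℝ) (ε : ℝ≥0) (x₀ x' : G.Strat i)
    (I : Info i.opp) : Prop :=
  ∀ y : G.Strat i.opp, (∀ a, FiniteAfter x' y (G.actSeq I a) (G.infoSeq I).length) →
    ∃ y₀ : G.Strat i.opp, G.AvoidsFrom I y₀ ∧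
      infoSum (G.coef i x₀) y₀ I ≤ infoSum (G.coef i x') y I + C * ε

open Classical in
/-- If the corrections below a sequence are effective, then so is their sum. -/
theorem exists_glue_seqSum_le [Fintype (Info i.opp)] {C : Info i.opp → ℝ} (hC : ∀ I, 0 ≤ C I)
    {ε : ℝ≥0} {x₀ x' : G.Strat i} {D : ℝ} (hx : x₀.Close (D * ε) x') {p : List (Info i.opp × A)}
    (h : ∀ I, G.infoSeq I = p → G.CorrectedAt (C I) ε x₀ x' I) {y : G.Strat i.opp}
    (hy : FiniteAfter x' y p p.length) :
    ∃ Y : Info i.opp → G.Strat i.opp, (∀ I, G.infoSeq I = p → G.AvoidsFrom I (Y I)) ∧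
      seqSum (G.coef i x₀) (Strategy.glue p Y y) p ≤
        seqSum (G.coef i x') y p + (G.lipConst i * D + ∑ I, C I) * ε := by
  have hT := G.perfectRecall
  have hY : ∀ I, ∃ y₀ : G.Strat i.opp, G.infoSeq I = p → G.AvoidsFrom I y₀ ∧
      infoSum (G.coef i x₀) y₀ I ≤ infoSum (G.coef i x') y I + C I * ε := by
    intro I
    by_cases hI : G.infoSeq I = p
    · obtain ⟨y₀, h1⟩ := h I hI y fun a => by
        rw [hI]
        exact hy.mono_prefix (by rw [← hI]; exact List.prefix_append _ _)
      exact ⟨y₀, fun _ => h1⟩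
    · exact ⟨y, fun h => absurd h hI⟩
  choose Y hY using hY
  refine ⟨Y, fun I hI => (hY I hI).1, ?_⟩
  rw [seqSum_glue hT, seqSum_eq hT _ y]
  have h1 := leafSum_coef_le hx p
  have h2 : (∑ I, if G.infoSeq I = p then infoSum (G.coef i x₀) (Y I) I else 0) ≤
      (∑ I, if G.infoSeq I = p then infoSum (G.coef i x') y I else 0) + (∑ I, C I) * ε := by
    rw [Finset.sum_mul, ← Finset.sum_add_distrib]
    refine Finset.sum_le_sum fun I _ => ?_
    split_ifs with hI
    · exact (hY I hI).2
    · have := mul_nonneg (hC I) ε.2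
      simpa using this
  rw [add_mul, mul_assoc]
  linarith

/-- The value at `I` is the average over the actions played there, so some action played is at most
the average. -/
theorem exists_prob_pos_seqSum_le (g : List A → ℝ) (y : G.Strat i.opp) (I : Info i.opp) :
    ∃ a ∈ G.acts i.opp I, 0 < y.prob I a ∧ seqSum g y (G.actSeq I a) ≤ infoSum g y I := by
  by_contra! hcon
  have hlt : ∑ a ∈ G.acts i.opp I, y.prob I a * infoSum g y I <
      ∑ a ∈ G.acts i.opp I, y.prob I a * seqSum g y (G.actSeq I a) := by
    have hle : ∀ a ∈ G.acts i.opp I, y.prob I a * infoSum g y I ≤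
        y.prob I a * seqSum g y (G.actSeq I a) := by
      intro a ha
      rcases (y.nonneg I a).eq_or_lt with h0 | h0
      · rw [← h0, zero_mul, zero_mul]
      · exact mul_le_mul_of_nonneg_left (hcon a ha h0).le h0.le
    obtain ⟨a, ha, hpos⟩ : ∃ a ∈ G.acts i.opp I, 0 < y.prob I a := by
      by_contra! hz
      have := Finset.sum_nonpos hz
      rw [y.sum_one I] at this
      linarith
    exact Finset.sum_lt_sum hle ⟨a, ha, mul_lt_mul_of_pos_left (hcon a ha hpos) hpos⟩
  rw [← Finset.sum_mul, y.sum_one, one_mul, ← infoSum_eq G.perfectRecall] at hlt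
  exact lt_irrefl _ hlt

/-- The part of `CorrectedAt` that concerns continuations through the action `a`. -/
def CorrectedAtAction (G : Pseudogame A Info) {i : Player} (C : ℝ) (ε : ℝ≥0) (x₀ x' : G.Strat i)
    (I : Info i.opp) (a : A) : Prop :=
  ∀ y : G.Strat i.opp, 0 < y.prob I a →
    FiniteAfter x' y (G.actSeq I a) (G.actSeq I a).length →
    ∃ y₀ : G.Strat i.opp, G.AvoidsFrom I y₀ ∧
      infoSum (G.coef i x₀) y₀ I ≤ seqSum (G.coef i x') y (G.actSeq I a) + C * ε

/-- The failed test at `w` says that restricting the opponent to avoiding continuations from `I`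
costs nothing compared with playing `a`. The constant collects a slack `ε` for an infimum that need
not be attained and two Lipschitz errors, from `x₀` to `w` and from `w` to `x'`. -/
theorem correctedAtAction_of_not_lt {D D' : ℝ} {ε : ℝ≥0} (hε : 0 < ε) {x₀ w x' : G.Strat i}
    (hw : x₀.Close (D' * ε) w) (hx' : x₀.Close (D * ε) x') (hsupp : w.SuppLE x')
    {I : Info i.opp} {a : A} (hcond : ¬ G.bestValue w I a < G.restrictedValue w I) :
    G.CorrectedAtAction (1 + G.lipConst i * D' + G.lipConst i * (D' + D)) ε x₀ x' I a := by
  intro y _ hfa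
  have hε' : (0 : ℝ) < ε := hε
  have hlt : G.restrictedValue w I <
      ((seqSum (G.coef i w) y (G.actSeq I a) + ε : ℝ) : EReal) := by
    refine (not_lt.1 hcond).trans_lt ((bestValue_le (hfa.of_suppLE hsupp)).trans_lt ?_)
    rw [EReal.coe_lt_coe_iff]
    linarith
  obtain ⟨y₀, hy₀, hlt⟩ := exists_of_restrictedValue_lt hlt
  rw [EReal.coe_lt_coe_iff] at hlt
  refine ⟨y₀, hy₀, ?_⟩
  have h1 := infoSum_coef_le hw y₀ I
  have h2 := seqSum_coef_le (hw.symm.trans hx') y (G.actSeq I a)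
  have e : (1 + G.lipConst i * D' + G.lipConst i * (D' + D)) * (ε : ℝ) =
      ε + G.lipConst i * (D' * ε) + G.lipConst i * (D' * ε + D * ε) := by ring
  rw [e]
  linarith

theorem correctedAtAction_of_addMass [Fintype (Info i.opp)] {C : Info i.opp → ℝ}
    (hC : ∀ I, 0 ≤ C I) {D : ℝ} {ε : ℝ≥0} (hε : 0 < ε) {x₀ w x' : G.Strat i}
    (hx' : x₀.Close (D * ε) x') {I : Info i.opp} {a : A} (ha : a ∈ G.acts i.opp I)
    (hsupp : (w.addMass {r | G.payoff i r (G.actSeq I a) = ⊤} ε).SuppLE x')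
    (hcor : ∀ I', G.infoSeq I' = G.actSeq I a → G.CorrectedAt (C I') ε x₀ x' I') :
    G.CorrectedAtAction (G.lipConst i * D + ∑ I', C I') ε x₀ x' I a := by
  intro y _ hfa
  -- The added mass reaches every own sequence with payoff `⊤` against `I a`, and `x'` keeps that
  -- support; so a bad `I a` would contradict the finiteness of `y`.
  have hbad : ¬ G.Bad i (G.actSeq I a) := by
    rintro ⟨z, hz, hzs, hcz, htop⟩
    have hr : G.payoff i (G.seq i z) (G.actSeq I a) = ⊤ := by
      rw [← hzs]
      exact payoff_eq_top hz hcz htop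
    refine hfa z hz (by rw [hzs]) hcz (hsupp.weight_pos (Strategy.addMass_weight_pos
      G.perfectRecall w hε (mem_hist_of_mem_terminals hz) hr)) ?_ htop
    rw [hzs, List.drop_length, Strategy.weight_nil]
    exact zero_lt_one
  obtain ⟨Y, hY, hle⟩ := exists_glue_seqSum_le hC hx' hcor hfa
  refine ⟨_, avoidsFrom_play_glue ha hbad hY y, ?_⟩
  rw [infoSum_play G.perfectRecall]
  exact hle

/-- `Correct(I)`, with recursion depth bounded by `n`, is effective up to a constant. -/
def CorrectEffective (o : G.toGameTree.LoopOrder) (n : ℕ) (I : Info i.opp) : Prop :=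
  ∀ D : ℝ, 0 ≤ D → ∃ C : ℝ, 0 ≤ C ∧ ∀ ε : ℝ≥0, 0 < ε → ∀ x₀ x x' : G.Strat i,
    x₀.Close (D * ε) x → x₀.Close (D * ε) x' → (G.correct o ε n x I).SuppLE x' →
      G.CorrectedAt C ε x₀ x' I

theorem exists_correctedAtAction [Fintype (Info i)] [Fintype (Info i.opp)]
    (o : G.toGameTree.LoopOrder) {n : ℕ} {I : Info i.opp} {a : A} (ha : a ∈ G.acts i.opp I)
    (ih : ∀ I' : Info i.opp, G.infoSeq I' = G.actSeq I a → G.CorrectEffective o n I')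
    {D : ℝ} (hD : 0 ≤ D) {D' : ℝ} (hD' : D ≤ D') :
    ∃ C : ℝ, 0 ≤ C ∧ ∀ ε : ℝ≥0, 0 < ε → ∀ x₀ w x' : G.Strat i, x₀.Close (D' * ε) w →
      x₀.Close (D * ε) x' → (G.correctAction o ε n I w a).SuppLE x' →
        G.CorrectedAtAction C ε x₀ x' I a := by
  classical
  have hL : 0 ≤ G.lipConst i := lipConst_nonneg
  have hD0 : 0 ≤ D' := hD.trans hD'
  obtain ⟨K, hK, hstep⟩ := Strategy.exists_foldl_step
    (f := fun ε (x : G.Strat i) I' => G.correct o ε n x I')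
    (l := (o.infos i.opp).filter fun I' => G.infoSeq I' = G.actSeq I a)
    fun I' _ => exists_correct_step o n I'
  obtain ⟨c, hc, hadd⟩ : ∃ c : ℝ, 0 ≤ c ∧ ∀ ε (x : G.Strat i) S, x.Step c ε (x.addMass S ε) :=
    ⟨_, by positivity, fun ε x S => x.addMass_step S ε⟩
  have hch : ∀ I' : Info i.opp, ∃ C : ℝ, 0 ≤ C ∧ (G.infoSeq I' = G.actSeq I a →
      ∀ ε : ℝ≥0, 0 < ε → ∀ x₀ x x' : G.Strat i, x₀.Close ((D' + c + K) * ε) x →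
        x₀.Close ((D' + c + K) * ε) x' → (G.correct o ε n x I').SuppLE x' →
        G.CorrectedAt C ε x₀ x' I') := by
    intro I'
    by_cases hI' : G.infoSeq I' = G.actSeq I a
    · obtain ⟨C, hC, h⟩ := ih I' hI' (D' + c + K) (by positivity)
      exact ⟨C, hC, fun _ => h⟩
    · exact ⟨0, le_rfl, fun h => absurd h hI'⟩
  choose C hC hCI using hch
  have hCs : 0 ≤ ∑ I', C I' := Finset.sum_nonneg fun I' _ => hC I'
  have h1 : 0 ≤ 1 + G.lipConst i * D' + G.lipConst i * (D' + D) := by positivity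
  have h2 : 0 ≤ G.lipConst i * D + ∑ I', C I' := by positivity
  -- Which branch the test takes depends on `ε` and `w`, so the uniform constant is the sum of those
  -- of both branches.
  refine ⟨_, add_nonneg h1 h2, ?_⟩
  intro ε hε x₀ w x' hw hx' hsupp y hya hfa
  unfold correctAction at hsupp
  split_ifs at hsupp with hcond
  · obtain ⟨hst, hs⟩ := hstep ε (w.addMass {r | G.payoff i r (G.actSeq I a) = ⊤} ε)
    have hcor : ∀ I', G.infoSeq I' = G.actSeq I a → G.CorrectedAt (C I') ε x₀ x' I' := by
      intro I' hI'
      obtain ⟨w', hw1, hw2⟩ := hs I' (by simp [o.mem_infos, hI'])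
      refine hCI I' hI' ε hε x₀ w' x' ?_ (hx'.mono ?_) (hw2.1.trans hsupp)
      · rw [add_mul, add_mul]
        exact (hw.trans (hadd ε w _).2).trans hw1.2
      · exact mul_le_mul_of_nonneg_right (by linarith) ε.2
    obtain ⟨y₀, hy₀, hle⟩ := correctedAtAction_of_addMass hC hε hx' ha (hst.1.trans hsupp) hcor
      y hya hfa
    exact ⟨y₀, hy₀, hle.trans (add_le_add le_rfl
      (mul_le_mul_of_nonneg_right (le_add_of_nonneg_left h1) ε.2))⟩
  · obtain ⟨y₀, hy₀, hle⟩ := correctedAtAction_of_not_lt hε hw hx' hsupp hcond y hya hfa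
    exact ⟨y₀, hy₀, hle.trans (add_le_add le_rfl
      (mul_le_mul_of_nonneg_right (le_add_of_nonneg_right h2) ε.2))⟩

/-- It suffices to treat one action that `y` plays at no more than average cost: its correction
happened at some intermediate `w`, and the final strategy keeps the support gained there. -/
theorem correctEffective_succ [Fintype (Info i)] [Fintype (Info i.opp)]
    (o : G.toGameTree.LoopOrder) {n : ℕ} {I : Info i.opp}
    (ih : ∀ a, ∀ I' : Info i.opp, G.infoSeq I' = G.actSeq I a → G.CorrectEffective o n I') :
    G.CorrectEffective o (n + 1) I := by
  intro D hD
  obtain ⟨K, hK, hstep⟩ := Strategy.exists_foldl_step (f := fun ε => G.correctAction o ε n I)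
    (l := o.acts i.opp I) fun a _ => exists_correctAction_step o (exists_correct_step o n) I a
  have key : ∀ a, ∃ C : ℝ, 0 ≤ C ∧ (a ∈ G.acts i.opp I → ∀ ε : ℝ≥0, 0 < ε →
      ∀ x₀ w x' : G.Strat i, x₀.Close ((D + K) * ε) w → x₀.Close (D * ε) x' →
        (G.correctAction o ε n I w a).SuppLE x' → G.CorrectedAtAction C ε x₀ x' I a) := by
    intro a
    by_cases ha : a ∈ G.acts i.opp I
    · obtain ⟨C, hC, h⟩ := exists_correctedAtAction o ha (ih a) hD (le_add_of_nonneg_right hK)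
      exact ⟨C, hC, fun _ => h⟩
    · exact ⟨0, le_rfl, fun h => absurd h ha⟩
  choose C hC hCa using key
  refine ⟨∑ a ∈ G.acts i.opp I, C a, Finset.sum_nonneg fun a _ => hC a, ?_⟩
  intro ε hε x₀ x x' hx hx' hsupp y hfin
  rw [correct_succ] at hsupp
  obtain ⟨b, hb, hbpos, hbmin⟩ := exists_prob_pos_seqSum_le (G.coef i x') y I
  obtain ⟨w, hw1, hw2⟩ := (hstep ε x).2 b ((o.mem_acts _ _ _).2 hb)
  obtain ⟨y₀, hy₀, hle⟩ := hCa b hb ε hε x₀ w x' (by rw [add_mul]; exact hx.trans hw1.2) hx'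
    (hw2.1.trans hsupp) y hbpos ((hfin b).of_prob_pos hbpos)
  exact ⟨y₀, hy₀, hle.trans (add_le_add hbmin (mul_le_mul_of_nonneg_right
    (Finset.single_le_sum (fun a _ => hC a) hb) ε.2))⟩

/-- Each recursive call lengthens the parent sequence by one, and these lengths stay below the
number of information sets. Hence depth 0 never occurs under this hypothesis. -/
theorem correctEffective [Fintype (Info i)] [Fintype (Info i.opp)]
    (o : G.toGameTree.LoopOrder) (n : ℕ) : ∀ I : Info i.opp,
      Fintype.card (Info i.opp) ≤ n + (G.infoSeq I).length → G.CorrectEffective o n I := by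
  induction n with
  | zero =>
    intro I hI
    have := length_infoSeq_lt G.perfectRecall I
    omega
  | succ n ih =>
    intro I hI
    refine correctEffective_succ o fun a I' hI' => ih I' ?_
    rw [hI', actSeq, List.length_append, List.length_singleton]
    omega

/-! ### From a corrected optimistic profile to an equilibrium. -/

theorem card_infos (o : G.toGameTree.LoopOrder) (j : Player) [Fintype (Info j)] :
    Fintype.card (Info j) = (o.infos j).length := by
  rw [Fintype.card_congr (Equiv.refl _), @Fintype.card_congr _ _ _ (fintypeInfo o j) (Equiv.refl _)]
  rfl

/-- The correction only enlarges the support. -/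
theorem suppLE_corrected (o : G.toGameTree.LoopOrder) (ε : ℝ≥0) (x : G.Strat i) :
    x.SuppLE (G.corrected o ε x) := by
  classical
  let _ := fintypeInfo o i
  obtain ⟨K, -, h⟩ := Strategy.exists_foldl_step
    (f := fun ε (x : G.Strat i) I => G.correct o ε (o.infos i.opp).length x I)
    (l := (o.infos i.opp).filter fun I => G.infoSeq I = [])
    fun I _ => exists_correct_step o _ I
  exact (h ε x).1.1

/-- Effectiveness at the root information sets yields avoiding continuations there; glued together
they form an avoiding strategy that witnesses the bound on `avoidValue`. -/
theorem exists_avoidValue_le_corrected (o : G.toGameTree.LoopOrder) (hA : G.Avoidable i)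
    (x₀ : G.Strat i) : ∃ C : ℝ, 0 ≤ C ∧ ∀ ε : ℝ≥0, 0 < ε → ∀ y : G.Strat i.opp,
      (∀ z ∈ G.terminals, 0 < reach i (G.corrected o ε x₀) y z → G.upper i z ≠ ⊤) →
        G.avoidValue i x₀ ≤ (∑ z ∈ G.terminals,
          reach i (G.corrected o ε x₀) y z * (G.upper i z).toReal + C * ε : ℝ) := by
  classical
  let _ := fintypeInfo o i
  let _ := fintypeInfo o i.opp
  have hT := G.perfectRecall
  obtain ⟨K, hK, hstep⟩ := Strategy.exists_foldl_step
    (f := fun ε (x : G.Strat i) I => G.correct o ε (o.infos i.opp).length x I)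
    (l := (o.infos i.opp).filter fun I => G.infoSeq I = [])
    fun I _ => exists_correct_step o _ I
  choose C hC hCI using fun I : Info i.opp =>
    correctEffective o (o.infos i.opp).length I
      ((card_infos o i.opp).le.trans (Nat.le_add_right _ _)) K hK
  refine ⟨G.lipConst i * K + ∑ I, C I,
    add_nonneg (mul_nonneg lipConst_nonneg hK) (Finset.sum_nonneg fun I _ => hC I), ?_⟩
  intro ε hε y hfin
  rw [← seqSum_coef_nil]
  obtain ⟨h1, h2⟩ := hstep ε x₀
  have hcor : ∀ I, G.infoSeq I = [] →
      G.CorrectedAt (C I) ε x₀ (G.corrected o ε x₀) I := by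
    intro I hI
    obtain ⟨w, hw1, hw2⟩ := h2 I (by simp [o.mem_infos, hI])
    exact hCI I ε hε x₀ w _ hw1.2 h1.2 hw2.1
  obtain ⟨Y, hY, hle⟩ := exists_glue_seqSum_le (p := []) (y := y) hC h1.2 hcor
    fun z hz _ hc hx hy => hfin z hz (mul_pos (mul_pos hc hx) hy)
  refine (avoidValue_le x₀ (y := Strategy.glue [] Y y) ?_).trans (EReal.coe_le_coe_iff.2 hle)
  intro s hs
  obtain ⟨z, hz, hzs, -⟩ := id hs
  have hz' := mem_hist_of_mem_terminals hz
  -- An empty bad sequence is excluded by avoidability, as no strategy gives it weight 0.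
  rcases s with _ | ⟨⟨J, c⟩, t⟩
  · obtain ⟨y₁, hy₁⟩ := hA
    have := hy₁ _ hs
    simp [Strategy.weight_nil] at this
  · have hJ := (infoSeq_of_seq_eq hT hz' (s := []) hzs).1
    rw [Strategy.glue_weight hT hz' (p := []) hzs]
    have := hY J hJ _ hs ⟨c, t, by simp [actSeq, hJ]⟩
    rwa [hJ] at this

/-- If avoiding were impossible, `x₀` would get `⊤` against `y`; but every node that it reaches is
also reached by `x`. -/
theorem avoidable_of_finite {x₀ : G.Strat i}
    (hx₀ : G.IsOptimistic i x₀) {x : G.Strat i} (hx : x₀.SuppLE x) {y : G.Strat i.opp}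
    (hfin : ∀ z ∈ G.terminals, 0 < reach i x y z → G.upper i z ≠ ⊤) : G.Avoidable i := by
  by_contra hA
  have htop := hx₀.2 hA y
  rw [value_eq_coe] at htop
  · exact EReal.coe_ne_top _ htop
  · intro z hz hr
    obtain ⟨h1, h2, h3⟩ := pos_of_weight_product_pos hz hr
    exact hfin z hz (mul_pos (mul_pos h1 (hx.weight_pos h2)) h3)

/-- The equilibrium consists of the minimax opponents: `y` caps player one at her optimistic value,
and `x` caps player two at his. -/
theorem isNash_of_avoidValue_add_nonpos {x₀ : G.Strat .one} {y₀ : G.Strat .two}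
    (hx₀ : G.IsOptimistic .one x₀) (hy₀ : G.IsOptimistic .two y₀) (h1 : G.Avoidable .one)
    (h2 : G.Avoidable .two) (h : G.avoidValue .one x₀ ≤ -G.avoidValue .two y₀) :
    ∃ x y, G.IsNash 0 x y := by
  obtain ⟨y, -, hy⟩ := exists_avoids_forall_value_le h1 hx₀
  obtain ⟨x, -, hx⟩ := exists_avoids_forall_value_le h2 hy₀
  refine ⟨x, y, (isNash_zero_iff x y).2 ((iSup_le hy).trans (h.trans (le_iInf fun y' => ?_)))⟩
  have := EReal.neg_le_neg_iff.2 (hx y')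
  rwa [← value_lower_one (G := G) x y'] at this

theorem exists_isNash_of_correctedOptimistic (o : G.toGameTree.LoopOrder)
    {x : ℝ≥0 → G.Strat .one} {y : ℝ≥0 → G.Strat .two} (h : G.IsCorrectedOptimistic o x y)
    (hs : ∀ᶠ ε in 𝓝[>] (0 : ℝ≥0), G.NoPseudoterminalInSupport (x ε) (y ε)) :
    ∃ x y, G.IsNash 0 x y := by
  obtain ⟨x₀, y₀, hx₀, hy₀, hx, hy⟩ := h
  have hfin : ∀ ε, G.NoPseudoterminalInSupport (x ε) (y ε) → ∀ z ∈ G.terminals,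
      0 < reach .one (x ε) (y ε) z → G.upper .one z ≠ ⊤ ∧ G.upper .two z ≠ ⊤ ∧
        (G.upper .one z).toReal = -(G.upper .two z).toReal := by
    intro ε hε z hz hr
    have he := (not_pseudoterminal_iff hz).1 fun hp => hε z hp hr
    have hb1 := G.bot_lt_upper .one z hz
    have hb2 := G.bot_lt_upper .two z hz
    refine ⟨?_, ?_, by rw [he, _root_.EReal.toReal_neg_eq]⟩
    · rw [he]
      intro h
      rw [EReal.neg_eq_top_iff] at h
      exact hb2.ne' h
    · intro h
      rw [h, EReal.neg_top] at he
      exact hb1.ne' he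
  have hfin2 : ∀ ε, G.NoPseudoterminalInSupport (x ε) (y ε) → ∀ z ∈ G.terminals,
      0 < reach (T := G.toGameTree) .two (y ε) (x ε) z → G.upper .two z ≠ ⊤ :=
    fun ε hε z hz hr => (hfin ε hε z hz (by rwa [reach_swap] at hr)).2.1
  obtain ⟨ε₁, hε₁⟩ := hs.exists
  have hA1 : G.Avoidable .one := avoidable_of_finite hx₀
    (suppLE_corrected o ε₁ x₀) (y := y ε₁) (by rw [← hx]; exact fun z hz hr => (hfin ε₁ hε₁ z hz hr).1)
  have hA2 : G.Avoidable .two := avoidable_of_finite (i := .two) hy₀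
    (suppLE_corrected (i := .two) o ε₁ y₀) (y := x ε₁) (by rw [← hy]; exact hfin2 ε₁ hε₁)
  refine isNash_of_avoidValue_add_nonpos hx₀ hy₀ hA1 hA2 ?_
  obtain ⟨C, hC, hle⟩ := exists_avoidValue_le_corrected o hA1 x₀
  obtain ⟨C', hC', hle'⟩ := exists_avoidValue_le_corrected (i := .two) o hA2 y₀
  -- A single number `F` serves both players: on the support both bounds are finite and
  -- $\beta_2=-\beta_1$, so player two's expectation is `-F`.
  have hmain : ∀ᶠ ε : ℝ≥0 in 𝓝[>] (0 : ℝ≥0), ∃ F : ℝ, G.avoidValue .one x₀ ≤ (F + C * ε : ℝ) ∧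
      G.avoidValue .two y₀ ≤ (-F + C' * ε : ℝ) := by
    filter_upwards [hs, self_mem_nhdsWithin] with ε hε hpos
    refine ⟨∑ z ∈ G.terminals, reach .one (x ε) (y ε) z * (G.upper .one z).toReal, ?_, ?_⟩
    · have := hle ε hpos (y ε) (by rw [← hx]; exact fun z hz hr => (hfin ε hε z hz hr).1)
      rwa [← hx] at this
    · have := hle' ε hpos (x ε) (by rw [← hy]; exact hfin2 ε hε)
      rw [← hy] at this
      convert this using 3
      rw [← Finset.sum_neg_distrib]
      refine Finset.sum_congr rfl fun z hz => ?_
      rw [reach_swap]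
      rcases (reach_nonneg (i := .one) (x ε) (y ε) hz).eq_or_lt with h0 | h0
      · simp [← h0]
      · rw [(hfin ε hε z hz h0).2.2]
        ring
  generalize G.avoidValue .one x₀ = a at *
  generalize G.avoidValue .two y₀ = b at *
  -- The value `⊥` makes the claim trivial, and `⊤` is ruled out by the real upper bounds.
  induction a with
  | bot => exact bot_le
  | top =>
    obtain ⟨ε, F, h1, -⟩ := hmain.exists
    exact absurd h1 (EReal.coe_lt_top _).not_ge
  | coe a =>
    induction b with
    | bot => simp
    | top =>
      obtain ⟨ε, F, -, h1⟩ := hmain.exists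
      exact absurd h1 (EReal.coe_lt_top _).not_ge
    | coe b =>
      rw [← EReal.coe_neg, EReal.coe_le_coe_iff]
      have hlim : Filter.Tendsto (fun ε : ℝ≥0 => (C + C') * (ε : ℝ)) (𝓝[>] 0) (𝓝 0) := by
        have : Filter.Tendsto (fun ε : ℝ≥0 => (C + C') * (ε : ℝ)) (𝓝 0) (𝓝 ((C + C') * (0 : ℝ≥0))) :=
          (continuous_const.mul NNReal.continuous_coe).tendsto 0
        simpa using this.mono_left nhdsWithin_le_nhds
      have : a + b ≤ 0 := by
        refine ge_of_tendsto hlim ?_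
        filter_upwards [hmain] with ε hε
        obtain ⟨F, h1, h2⟩ := hε
        rw [EReal.coe_le_coe_iff] at h1 h2
        linarith
      linarith

end Pseudogame

end ZeroSum

end

theorem mainTheorem5 {A : Type*} {Info : ZeroSum.Player → Type*} (G : ZeroSum.Pseudogame A Info)
    (o : G.toGameTree.LoopOrder) :
    (∃ x y, G.IsNash 0 x y) ↔
      ∃ x y, G.IsCorrectedOptimistic o x y ∧
        ∀ᶠ ε in 𝓝[>] (0 : ℝ≥0), G.NoPseudoterminalInSupport (x ε) (y ε) := by
  constructor
  · rintro ⟨x, y, h⟩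
    obtain ⟨h1, h2⟩ := ZeroSum.Pseudogame.exists_correctedOptimistic_of_isNash o h
    exact ⟨_, _, h1, Filter.Eventually.of_forall fun _ => h2⟩
  · rintro ⟨x, y, h, hs⟩
    exact ZeroSum.Pseudogame.exists_isNash_of_correctedOptimistic o h hs
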